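/- A regular $n$-gon ($n\ge 3$) is regarded as a solid convex polygon $P$ in the Euclidean plane, and the doubled regular $n$-gon $X_n$ is the space obtained by gluing two copies of $P$ (the faces) along their boundaries by the identity, with the gluing metric: the distance between two points $x,y$ of the same face is the Euclidean distance, and the distance between points $x,y$ of different faces is $\min_{z\in\partial P}(|x-z|+|z-y|)$. Let $S^1=\mathbb{R}/2\pi\mathbb{Z}$. A closed geodesic in a metric space $X$ is a nonconstant closed curve $\gamma\colon S^1\to X$ of constant speed that is locally distance minimizing; it is a half-geodesic if, writing $l(\gamma)$ for its length, $d(\gamma(t),\gamma(t+\pi))=l(\gamma)/2$ for all $t\in S^1$. Proposition. Let $n\ge 3$ and let $X_n$ be a doubled regular $n$-gon. (1) If $n$ is odd, then $X_n$ has no half-geodesics. (2) If $n$ is even, then $X_n$ has exactly $n/2$ half-geodesics, where curves that differ only by a change of base point or of orientation are regarded as the same. They are precisely the closed curves which run once, at constant speed, straight from the midpoint of an edge to the midpoint of the opposite (parallel) edge in one face and straight back in the other face; each of these passes through the center of each face and meets the two edges perpendicularly. -/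

import Mathlib

noncomputable section

namespace DoubledPolygon

/-- The circle of circumference `2π`, on which closed curves are parametrized. -/
abbrev Circ : Type := AddCircle (2 * Real.pi)

section Geodesics

variable {X : Type*} [MetricSpace X]

/-- The length of a closed curve: its total variation over one period. -/
def curveLength (γ : Circ → X) : ENNReal :=
  eVariationOn (fun t : ℝ => γ (t : Circ)) (Set.Icc 0 (2 * Real.pi))

/-- A (nontrivial) closed geodesic: a closed curve of constant speed `v > 0` that is locally
distance minimizing. -/
def IsClosedGeodesic (γ : Circ → X) : Prop :=
  ∃ v : ℝ, 0 < v ∧ ∀ t : ℝ, ∃ ε : ℝ, 0 < ε ∧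
    ∀ a ∈ Set.Ioo (t - ε) (t + ε), ∀ b ∈ Set.Ioo (t - ε) (t + ε),
      dist (γ (a : Circ)) (γ (b : Circ)) = v * |a - b|

/-- A `1/k`-geodesic (`k ≥ 1`): a closed geodesic that is minimizing on all subintervals of length
`l(γ)/k`. -/
def IsOneDivGeodesic (k : ℕ) (γ : Circ → X) : Prop :=
  IsClosedGeodesic γ ∧
    ∀ t : Circ, edist (γ t) (γ (t + ((2 * Real.pi / k : ℝ) : Circ))) = curveLength γ / k

/-- A half-geodesic is a `1/2`-geodesic. -/
def IsHalfGeodesic (γ : Circ → X) : Prop := IsOneDivGeodesic 2 γ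

variable (X) in
/-- Two parametrized half-geodesics are the same geometric curve if they differ by a change of
base point and possibly of orientation. -/
def halfGeodesicSetoid : Setoid {γ : Circ → X // IsHalfGeodesic γ} where
  r γ δ := ∃ s : Circ, (∀ t, δ.1 t = γ.1 (s + t)) ∨ (∀ t, δ.1 t = γ.1 (s - t))
  iseqv :=
    { refl := fun γ => ⟨0, Or.inl fun t => by rw [zero_add]⟩
      symm := by
        rintro γ δ ⟨s, h | h⟩
        · exact ⟨-s, Or.inl fun t => by rw [h]; exact congrArg γ.1 (by abel)⟩
        · exact ⟨s, Or.inr fun t => by rw [h]; exact congrArg γ.1 (by abel)⟩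
      trans := by
        rintro γ δ η ⟨s, h | h⟩ ⟨u, k | k⟩
        · exact ⟨s + u, Or.inl fun t => by rw [k, h]; exact congrArg γ.1 (by abel)⟩
        · exact ⟨s + u, Or.inr fun t => by rw [k, h]; exact congrArg γ.1 (by abel)⟩
        · exact ⟨s - u, Or.inr fun t => by rw [k, h]; exact congrArg γ.1 (by abel)⟩
        · exact ⟨s - u, Or.inl fun t => by rw [k, h]; exact congrArg γ.1 (by abel)⟩ }

variable (X) in
/-- Half-geodesics as unparametrized, unoriented closed curves. -/
abbrev GeometricHalfGeodesic : Type _ := Quotient (halfGeodesicSetoid X)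

end Geodesics

section Polygon

/-- The `k`-th vertex (`n`-periodic in `k`) of the regular `n`-gon in the plane `ℂ` with center `c`
and `0`-th vertex `c + w`. -/
def vertex (n : ℕ) (c w : ℂ) (k : ℕ) : ℂ :=
  c + w * Complex.exp (2 * Real.pi * Complex.I * k / n)

/-- The midpoint of the `k`-th edge, which joins the `k`-th vertex to the next one. -/
def edgeMidpoint (n : ℕ) (c w : ℂ) (k : ℕ) : ℂ :=
  midpoint ℝ (vertex n c w k) (vertex n c w (k + 1))

/-- The solid regular `n`-gon with center `c` and `0`-th vertex `c + w`. -/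
def polygon (n : ℕ) (c w : ℂ) : Set ℂ := convexHull ℝ (Set.range (vertex n c w))

theorem finite_range_vertex (n : ℕ) (c w : ℂ) : (Set.range (vertex n c w)).Finite := by
  rcases Nat.eq_zero_or_pos n with rfl | hn
  · refine (Set.finite_singleton (c + w)).subset ?_
    rintro _ ⟨k, rfl⟩
    simp [vertex]
  · have hn' : (n : ℂ) ≠ 0 := by exact_mod_cast hn.ne'
    refine ((Finset.range n).finite_toSet.image (vertex n c w)).subset ?_
    rintro _ ⟨k, rfl⟩
    refine ⟨k % n, by simpa using Nat.mod_lt k hn, ?_⟩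
    unfold vertex
    congr 2
    rw [Complex.exp_eq_exp_iff_exists_int]
    refine ⟨-((k / n : ℕ) : ℤ), ?_⟩
    have h : (k : ℂ) = (n : ℂ) * ((k / n : ℕ) : ℂ) + ((k % n : ℕ) : ℂ) := by
      exact_mod_cast (Nat.div_add_mod k n).symm
    rw [h]
    generalize k / n = q
    push_cast
    field_simp
    ring

instance nonempty_frontier (n : ℕ) (c w : ℂ) : Nonempty (frontier (polygon n c w)) := by
  have hc : IsCompact (polygon n c w) := (finite_range_vertex n c w).isCompact_convexHull ℝ
  have hne : (polygon n c w).Nonempty := (Set.range_nonempty _).convexHull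
  exact (nonempty_frontier_iff.2 ⟨hne, hc.ne_univ⟩).to_subtype

/-- The inclusion of the boundary of the polygon into the polygon. -/
def boundaryIncl (n : ℕ) (c w : ℂ) (z : frontier (polygon n c w)) : polygon n c w :=
  ⟨z, ((finite_range_vertex n c w).isCompact_convexHull ℝ).isClosed.frontier_subset z.2⟩

theorem isometry_boundaryIncl (n : ℕ) (c w : ℂ) : Isometry (boundaryIncl n c w) :=
  fun _ _ => rfl

/-- The doubled regular `n`-gon: two copies of the polygon glued along their boundaries by the
identity. Its metric is the gluing metric: the Euclidean distance within each (convex) face, and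
`inf {|x - z| + |z - y| : z a boundary point}` for points `x`, `y` of different faces. -/
abbrev DoubledNGon (n : ℕ) (c w : ℂ) : Type :=
  Metric.GlueSpace (isometry_boundaryIncl n c w) (isometry_boundaryIncl n c w)

/-- The two faces of the doubled polygon. -/
def face (n : ℕ) (c w : ℂ) : Bool → polygon n c w → DoubledNGon n c w
  | false => Metric.toGlueL (isometry_boundaryIncl n c w) (isometry_boundaryIncl n c w)
  | true => Metric.toGlueR (isometry_boundaryIncl n c w) (isometry_boundaryIncl n c w)

/-- `x` is the point of face `i` at position `z` of the plane. -/
def IsFacePoint {n : ℕ} {c w : ℂ} (i : Bool) (z : ℂ) (x : DoubledNGon n c w) : Prop :=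
  ∃ h : z ∈ polygon n c w, x = face n c w i ⟨z, h⟩

/-- The closed curve `γ` goes once, at constant speed, around the double of the segment from `a`
to `b`: from `a` straight to `b` in one face, and straight back in the other one. -/
def RunsAround {n : ℕ} {c w : ℂ} (γ : Circ → DoubledNGon n c w) (a b : ℂ) : Prop :=
  ∃ s : ℝ, ∀ t ∈ Set.Icc (0 : ℝ) 1,
    IsFacePoint false (AffineMap.lineMap a b t) (γ ((s + Real.pi * t : ℝ) : Circ)) ∧
    IsFacePoint true (AffineMap.lineMap b a t) (γ ((s + Real.pi + Real.pi * t : ℝ) : Circ))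

/-- For even `n`: `γ` passes through the center of each face and crosses a pair of opposite
edges perpendicularly at their midpoints. -/
structure IsCentralCurve {n : ℕ} {c w : ℂ} (γ : Circ → DoubledNGon n c w) (k : ℕ) : Prop where
  runsAround : RunsAround γ (edgeMidpoint n c w k) (edgeMidpoint n c w (k + n / 2))
  center : ∀ i : Bool, ∃ t : Circ, IsFacePoint i c (γ t)
  perp : inner ℝ (edgeMidpoint n c w (k + n / 2) - edgeMidpoint n c w k)
    (vertex n c w (k + 1) - vertex n c w k) = 0
  perp_opposite : inner ℝ (edgeMidpoint n c w (k + n / 2) - edgeMidpoint n c w k)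
    (vertex n c w (k + n / 2 + 1) - vertex n c w (k + n / 2)) = 0

end Polygon

end DoubledPolygon

end

/-! A half-geodesic is, up to a scale factor, a distance-preserving copy of the circle
(`isHalfGeodesic_iff`): constant speed gives an upper bound for distances, and the antipodal
equality leaves no slack in it.

Such a curve meets the common boundary of the faces. Inside a single face, both arcs between two
antipodal points would be the same straight segment. From a boundary point `p` to its antipode `q`,
forgetting the face does not increase distance, so equality in the planar triangle inequality makes
both arcs project to the segment `pq`. Injectivity puts them in opposite faces, whence `q` is a
boundary point too (`exists_runsAround_of_dist_eq`). Comparing the two copies of the midpoint `m` of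
`pq` shows that every boundary point is at distance at least `|p - q| / 2` from `m`. Conversely this
condition suffices, since antipodal points have planar positions `a`, `b` with `a + b = 2m`, so that
`|a - z| + |b - z| ≥ 2|m - z|`.

What remains is planar (`even_and_eq_edgeMidpoint_of_le_dist`). The disc with diameter `pq` lies in
the polygon and touches its boundary at `p` and `q`, so the polygon lies in the strip between the
two tangents there. The width of the strip is at most twice the apothem `‖w‖ cos (π/n)`. For odd `n`
the polygon is strictly wider than that in every direction. For even `n` its width is at least that,
with equality only perpendicular to a pair of opposite edges; then the disc is the incircle and `p`,
`q` are opposite edge midpoints. Such pairs are indexed by `k < n / 2`. -/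

namespace DoubledPolygon

/-! ### The gluing metric in planar coordinates -/

section FacePoints

variable {n : ℕ} {c w : ℂ}

theorem isClosed_polygon (n : ℕ) (c w : ℂ) : IsClosed (polygon n c w) :=
  ((finite_range_vertex n c w).isCompact_convexHull ℝ).isClosed

theorem isometry_face (i : Bool) : Isometry (face n c w i) := by
  cases i
  · exact Metric.toGlueL_isometry _ _
  · exact Metric.toGlueR_isometry _ _

theorem dist_face_false_true (x y : polygon n c w) :
    dist (face n c w false x) (face n c w true y) =
      ⨅ z : frontier (polygon n c w), dist (x : ℂ) z + dist (y : ℂ) z := by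
  have h : dist (face n c w false x) (face n c w true y) =
      (⨅ z : frontier (polygon n c w),
        dist x (boundaryIncl n c w z) + dist y (boundaryIncl n c w z)) + 0 := rfl
  rw [h, add_zero]
  rfl

theorem exists_isFacePoint (x : DoubledNGon n c w) : ∃ i z, IsFacePoint i z x := by
  obtain ⟨x, rfl⟩ : ∃ y : polygon n c w ⊕ polygon n c w, (Quotient.mk'' y : DoubledNGon n c w) = x :=
    Quotient.exists_rep x
  rcases x with x | x
  · exact ⟨false, x, x.2, rfl⟩
  · exact ⟨true, x, x.2, rfl⟩

theorem isFacePoint_face {i : Bool} {z : ℂ} (h : z ∈ polygon n c w) :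
    IsFacePoint i z (face n c w i ⟨z, h⟩) := ⟨h, rfl⟩

theorem IsFacePoint.dist_eq {i : Bool} {a b : ℂ} {x y : DoubledNGon n c w}
    (hx : IsFacePoint i a x) (hy : IsFacePoint i b y) : dist x y = dist a b := by
  obtain ⟨ha, rfl⟩ := hx
  obtain ⟨hb, rfl⟩ := hy
  exact (isometry_face i).dist_eq _ _

theorem IsFacePoint.ext {i : Bool} {a : ℂ} {x y : DoubledNGon n c w}
    (hx : IsFacePoint i a x) (hy : IsFacePoint i a y) : x = y :=
  dist_eq_zero.1 (by rw [hx.dist_eq hy, dist_self])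

theorem IsFacePoint.dist_eq_iInf {i : Bool} {a b : ℂ} {x y : DoubledNGon n c w}
    (hx : IsFacePoint i a x) (hy : IsFacePoint (!i) b y) :
    dist x y = ⨅ z : frontier (polygon n c w), dist a z + dist b z := by
  obtain ⟨ha, rfl⟩ := hx
  obtain ⟨hb, rfl⟩ := hy
  cases i
  · exact dist_face_false_true _ _
  · rw [dist_comm]
    exact (dist_face_false_true _ _).trans (iInf_congr fun z => add_comm _ _)

/-- Folding the double onto the plane is 1-Lipschitz: a detour through a boundary point is never
shorter than the straight segment. -/
theorem IsFacePoint.dist_le {i j : Bool} {a b : ℂ} {x y : DoubledNGon n c w}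
    (hx : IsFacePoint i a x) (hy : IsFacePoint j b y) : dist a b ≤ dist x y := by
  by_cases h : j = i
  · subst h
    rw [hx.dist_eq hy]
  · obtain rfl : j = !i := Bool.eq_not.2 h
    rw [hx.dist_eq_iInf hy]
    exact le_ciInf fun z => dist_triangle_right a b z

theorem IsFacePoint.dist_le_add {i : Bool} {a b z : ℂ} {x y : DoubledNGon n c w}
    (hx : IsFacePoint i a x) (hy : IsFacePoint (!i) b y) (hz : z ∈ frontier (polygon n c w)) :
    dist x y ≤ dist a z + dist b z := by
  rw [hx.dist_eq_iInf hy]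
  exact ciInf_le (f := fun z : frontier (polygon n c w) => dist a z + dist b z)
    ⟨0, by rintro _ ⟨z, rfl⟩; positivity⟩ ⟨z, hz⟩

theorem IsFacePoint.le_dist {i : Bool} {a b : ℂ} {r : ℝ} {x y : DoubledNGon n c w}
    (hx : IsFacePoint i a x) (hy : IsFacePoint (!i) b y)
    (h : ∀ z ∈ frontier (polygon n c w), r ≤ dist a z + dist b z) : r ≤ dist x y := by
  rw [hx.dist_eq_iInf hy]
  exact le_ciInf fun z => h z z.2

theorem IsFacePoint.eq {i j : Bool} {a b : ℂ} {x : DoubledNGon n c w}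
    (hx : IsFacePoint i a x) (hy : IsFacePoint j b x) : a = b :=
  dist_le_zero.1 (by simpa using hx.dist_le hy)

theorem IsFacePoint.of_mem_frontier {i : Bool} {a : ℂ} {x : DoubledNGon n c w}
    (hx : IsFacePoint i a x) (ha : a ∈ frontier (polygon n c w)) (j : Bool) :
    IsFacePoint j a x := by
  by_cases h : j = i
  · rwa [h]
  · obtain rfl : j = !i := Bool.eq_not.2 h
    have hy := isFacePoint_face (i := !i) hx.1
    have : x = face n c w (!i) ⟨a, hx.1⟩ :=
      dist_le_zero.1 (by simpa using hx.dist_le_add hy ha)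
    rwa [← this] at hy

/-- The faces meet only along the boundary: a positive distance from `a` to the boundary would bound
the distance from `x` to itself from below. -/
theorem IsFacePoint.mem_frontier {i : Bool} {a b : ℂ} {x : DoubledNGon n c w}
    (hx : IsFacePoint i a x) (hy : IsFacePoint (!i) b x) : a ∈ frontier (polygon n c w) := by
  obtain rfl := hx.eq hy
  rw [← isClosed_frontier.closure_eq, Metric.mem_closure_iff]
  intro ε hε
  by_contra! h
  have := hx.le_dist hy (r := ε) fun z hz => (h z hz).trans (le_add_of_nonneg_left dist_nonneg)
  rw [dist_self] at this
  linarith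

theorem isClosed_setOf_isFacePoint (i : Bool) :
    IsClosed {x : DoubledNGon n c w | ∃ z, IsFacePoint i z x} := by
  have : CompactSpace (polygon n c w) :=
    isCompact_iff_compactSpace.1 ((finite_range_vertex n c w).isCompact_convexHull ℝ)
  convert! (isCompact_range (isometry_face (n := n) (c := c) (w := w) i).continuous).isClosed
  ext x
  constructor
  · rintro ⟨z, hz, rfl⟩
    exact ⟨_, rfl⟩
  · rintro ⟨z, rfl⟩
    exact ⟨z, z.2, rfl⟩

end FacePoints

/-! ### Half-geodesics as scaled isometric circles -/

section ConstantSpeed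

open Set

variable {X : Type*} [MetricSpace X]

theorem eVariationOn_Icc_of_dist_eq {f : ℝ → X} {v : ℝ} (hv : 0 ≤ v) {a b : ℝ} (hab : a ≤ b)
    (h : ∀ x ∈ Icc a b, ∀ y ∈ Icc a b, dist (f x) (f y) = v * |x - y|) :
    eVariationOn f (Icc a b) = ENNReal.ofReal (v * (b - a)) := by
  have hg : MonotoneOn (fun x : ℝ => v * x) (Icc a b) :=
    fun x _ y _ hxy => mul_le_mul_of_nonneg_left hxy hv
  apply le_antisymm
  · have h1 : eVariationOn f (Icc a b) = eVariationOn (fun x : ℝ => v * x) (Icc a b) := by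
      refine iSup_congr fun p => Finset.sum_congr rfl fun i _ => ?_
      rw [edist_dist, edist_dist, h _ (p.2.2.2 _) _ (p.2.2.2 _), Real.dist_eq, ← mul_sub, abs_mul,
        abs_of_nonneg hv]
    rw [h1, mul_sub]
    simpa using (hg.eVariationOn_eq (left_mem_Icc.2 hab) (right_mem_Icc.2 hab)).le
  · have := eVariationOn.edist_le f (right_mem_Icc.2 hab) (left_mem_Icc.2 hab)
    rwa [edist_dist, h _ (right_mem_Icc.2 hab) _ (left_mem_Icc.2 hab),
      abs_of_nonneg (sub_nonneg.2 hab)] at this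

/-- By compactness the interval splits into finitely many pieces on which the local formula holds,
and variation is additive. -/
theorem eVariationOn_Icc_of_local_dist_eq {f : ℝ → X} {v : ℝ} (hv : 0 ≤ v)
    (h : ∀ t : ℝ, ∃ ε : ℝ, 0 < ε ∧ ∀ a ∈ Ioo (t - ε) (t + ε), ∀ b ∈ Ioo (t - ε) (t + ε),
      dist (f a) (f b) = v * |a - b|) {a b : ℝ} (hab : a ≤ b) :
    eVariationOn f (Icc a b) = ENNReal.ofReal (v * (b - a)) := by
  choose ε hε hd using h
  obtain ⟨t, ht0, htm, ⟨m, hm⟩, ht⟩ := exists_monotone_Icc_subset_open_cover_Icc hab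
    (c := fun s : ℝ => Subtype.val ⁻¹' Ioo (s - ε s) (s + ε s))
    (fun s => isOpen_Ioo.preimage continuous_subtype_val)
    (fun x _ => mem_iUnion.2 ⟨x, by simp [hε]⟩)
  have key : ∀ k : ℕ, eVariationOn f (Icc a (t k)) = ENNReal.ofReal (v * (t k - a)) := by
    intro k
    induction k with
    | zero => simp [ht0]
    | succ k ih =>
      have h1 : (t k : ℝ) ≤ t (k + 1) := htm k.le_succ
      have h2 := eVariationOn.Icc_add_Icc f (s := univ) (t k).2.1 h1 (mem_univ _)
      simp only [univ_inter] at h2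
      obtain ⟨s, hs⟩ := ht k
      have hs' : ∀ x ∈ Icc (t k : ℝ) (t (k + 1)), x ∈ Ioo (s - ε s) (s + ε s) := fun x hx =>
        @hs ⟨x, (t k).2.1.trans hx.1, hx.2.trans (t (k + 1)).2.2⟩ ⟨hx.1, hx.2⟩
      rw [← h2, ih, eVariationOn_Icc_of_dist_eq hv h1 fun x hx y hy => hd s x (hs' x hx) y (hs' y hy),
        ← ENNReal.ofReal_add (mul_nonneg hv (sub_nonneg.2 (t k).2.1))
          (mul_nonneg hv (sub_nonneg.2 h1))]
      congr 1
      ring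
  simpa [hm m le_rfl] using key m

theorem coe_add_two_pi (t : ℝ) : ((t + 2 * Real.pi : ℝ) : Circ) = t :=
  AddCircle.coe_add_period _ t

theorem coe_add_pi_eq_coe_sub_pi (t : ℝ) : ((t + Real.pi : ℝ) : Circ) = ((t - Real.pi : ℝ) : Circ) := by
  rw [← coe_add_two_pi (t - Real.pi)]
  congr 1
  ring

/-- This replaces local minimality and length by a single metric identity, the only form used later.
Forward, arc length bounds distances above; the triangle inequality through the antipode of `s`
gives the matching lower bound. -/
theorem isHalfGeodesic_iff {γ : Circ → X} :
    IsHalfGeodesic γ ↔ ∃ v : ℝ, 0 < v ∧ ∀ s t : ℝ, |s - t| ≤ Real.pi →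
      dist (γ (s : Circ)) (γ (t : Circ)) = v * |s - t| := by
  have hpi := Real.pi_pos
  constructor
  · rintro ⟨⟨v, hv, hloc⟩, hhalf⟩
    refine ⟨v, hv, ?_⟩
    have hvar := fun {a b : ℝ} (hab : a ≤ b) =>
      eVariationOn_Icc_of_local_dist_eq (f := fun t : ℝ => γ (t : Circ)) hv.le hloc hab
    have hlip : ∀ s t : ℝ, s ≤ t → dist (γ (s : Circ)) (γ (t : Circ)) ≤ v * (t - s) := by
      intro s t hst
      have h1 := eVariationOn.edist_le (fun t : ℝ => γ (t : Circ)) (left_mem_Icc.2 hst)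
        (right_mem_Icc.2 hst)
      rw [hvar hst, edist_dist] at h1
      exact (ENNReal.ofReal_le_ofReal_iff (mul_nonneg hv.le (sub_nonneg.2 hst))).1 h1
    have hanti : ∀ s : ℝ, dist (γ (s : Circ)) (γ ((s + Real.pi : ℝ) : Circ)) = v * Real.pi := by
      intro s
      have h1 := hhalf (s : Circ)
      have h2 : (2 : ENNReal) = ENNReal.ofReal 2 := by simp
      rw [curveLength, hvar Real.two_pi_pos.le, ← AddCircle.coe_add, edist_dist, Nat.cast_ofNat,
        Nat.cast_ofNat, h2, ← ENNReal.ofReal_div_of_pos two_pos] at h1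
      have h3 := (ENNReal.ofReal_eq_ofReal_iff dist_nonneg (by linarith [mul_pos hv hpi])).1 h1
      rw [show s + Real.pi = s + 2 * Real.pi / 2 by ring, h3]
      ring
    have key : ∀ s t : ℝ, s ≤ t → t - s ≤ Real.pi →
        dist (γ (s : Circ)) (γ (t : Circ)) = v * (t - s) := by
      intro s t hst ht
      refine le_antisymm (hlip s t hst) ?_
      have h1 := dist_triangle (γ (s : Circ)) (γ (t : Circ)) (γ ((s + Real.pi : ℝ) : Circ))
      have h2 := hlip t (s + Real.pi) (by linarith)
      rw [hanti] at h1
      linarith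
    intro s t hst
    rcases le_total s t with h | h
    · rw [abs_sub_comm, abs_of_nonneg (sub_nonneg.2 h)] at hst ⊢
      exact key s t h hst
    · rw [abs_of_nonneg (sub_nonneg.2 h)] at hst ⊢
      rw [dist_comm]
      exact key t s h hst
  · rintro ⟨v, hv, H⟩
    have hloc : ∀ t : ℝ, ∃ ε : ℝ, 0 < ε ∧ ∀ a ∈ Ioo (t - ε) (t + ε), ∀ b ∈ Ioo (t - ε) (t + ε),
        dist (γ (a : Circ)) (γ (b : Circ)) = v * |a - b| := by
      refine fun t => ⟨1, one_pos, fun a ha b hb => H a b ?_⟩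
      have := Real.pi_gt_three
      exact abs_le.2 ⟨by linarith [ha.1, hb.2], by linarith [ha.2, hb.1]⟩
    refine ⟨⟨v, hv, hloc⟩, fun t => ?_⟩
    induction t using QuotientAddGroup.induction_on with
    | H t =>
      have h2 : (2 : ENNReal) = ENNReal.ofReal 2 := by simp
      rw [curveLength, eVariationOn_Icc_of_local_dist_eq (f := fun t : ℝ => γ (t : Circ)) hv.le hloc
        Real.two_pi_pos.le, ← AddCircle.coe_add, edist_dist, Nat.cast_ofNat,
        Nat.cast_ofNat, h2, ← ENNReal.ofReal_div_of_pos two_pos, H _ _ (by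
          rw [abs_sub_comm, add_sub_cancel_left, abs_of_pos (by positivity)]; linarith),
        abs_sub_comm, add_sub_cancel_left, abs_of_pos (by positivity)]
      congr 1
      ring

end ConstantSpeed

/-! ### Vertices, edge normals and the inscribed disc -/

section RegularPolygon

open ComplexConjugate

/-- The vector from the center of the regular `n`-gon to its `k`-th vertex. -/
noncomputable def ray (n : ℕ) (w : ℂ) (k : ℕ) : ℂ := w * Complex.exp (2 * Real.pi * Complex.I * k / n)

/-- The outward normal vector of the `k`-th edge of the regular `n`-gon, as long as the radius. -/
noncomputable def edgeNormal (n : ℕ) (w : ℂ) (k : ℕ) : ℂ :=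
  ray n w k * Complex.exp ((Real.pi / n : ℝ) * Complex.I)

variable {n : ℕ} {c w : ℂ}

theorem vertex_eq (k : ℕ) : vertex n c w k = c + ray n w k := rfl

theorem ray_add (j k : ℕ) :
    ray n w (j + k) = ray n w j * Complex.exp ((2 * Real.pi * k / n : ℝ) * Complex.I) := by
  rw [ray, ray, mul_assoc w, ← Complex.exp_add]
  push_cast
  congr 2
  ring

theorem edgeMidpoint_eq (k : ℕ) :
    edgeMidpoint n c w k = c + (Real.cos (Real.pi / n) : ℝ) * edgeNormal n w k := by
  rw [edgeMidpoint, midpoint_eq_smul_add, vertex_eq, vertex_eq, ray_add, edgeNormal,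
    Complex.ofReal_cos, Complex.cos, invOf_eq_inv, Complex.real_smul]
  have h1 : Complex.exp ((2 * Real.pi * (1 : ℕ) / n : ℝ) * Complex.I) =
      Complex.exp ((Real.pi / n : ℝ) * Complex.I) * Complex.exp ((Real.pi / n : ℝ) * Complex.I) := by
    rw [← Complex.exp_add]
    push_cast
    congr 1
    ring
  have h2 : Complex.exp (-(Real.pi / n : ℝ) * Complex.I) *
      Complex.exp ((Real.pi / n : ℝ) * Complex.I) = 1 := by
    rw [← Complex.exp_add, neg_mul, neg_add_cancel, Complex.exp_zero]
  rw [h1]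
  push_cast at h2 ⊢
  linear_combination (-ray n w k / 2) * h2

theorem norm_ray (k : ℕ) : ‖ray n w k‖ = ‖w‖ := by
  rw [ray, norm_mul, show 2 * (Real.pi : ℂ) * Complex.I * k / n =
    ((2 * Real.pi * k / n : ℝ) : ℂ) * Complex.I by push_cast; ring,
    Complex.norm_exp_ofReal_mul_I, mul_one]

theorem norm_edgeNormal (k : ℕ) : ‖edgeNormal n w k‖ = ‖w‖ := by
  rw [edgeNormal, norm_mul, norm_ray, Complex.norm_exp_ofReal_mul_I, mul_one]

theorem ray_add_self (hn : 0 < n) (k : ℕ) : ray n w (k + n) = ray n w k := by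
  have hn' : (n : ℝ) ≠ 0 := by positivity
  rw [ray_add, mul_div_cancel_right₀ _ hn']
  push_cast
  rw [Complex.exp_two_pi_mul_I, mul_one]

theorem ray_add_half (hn : 0 < n) (he : Even n) (k : ℕ) : ray n w (k + n / 2) = -ray n w k := by
  have hn' : (n : ℝ) ≠ 0 := by positivity
  have h : ((n / 2 : ℕ) : ℝ) = n / 2 := Nat.cast_div he.two_dvd (by norm_num)
  rw [ray_add, h, show 2 * Real.pi * ((n : ℝ) / 2) / n = Real.pi by field_simp,
    Complex.exp_pi_mul_I, mul_neg_one]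

/-- Vertex directions are spaced by `2π/n`, so one of them is within `π/n` of `u`; `φ` is the signed
angle from `u` to it, found by rounding. -/
theorem exists_conj_mul_ray (hn : 0 < n) (u w : ℂ) :
    ∃ (k : ℕ) (φ : ℝ), |φ| ≤ Real.pi / n ∧
      conj u * ray n w k = (‖u‖ * ‖w‖ : ℝ) * Complex.exp (φ * Complex.I) := by
  have hn' : (0 : ℝ) < n := by positivity
  have hnC : (n : ℂ) ≠ 0 := by exact_mod_cast hn.ne'
  have hpi := Real.pi_pos
  set θ := Complex.arg (conj u * w) with hθ
  set x : ℝ := -θ * n / (2 * Real.pi) with hx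
  set j : ℤ := round x with hj
  set k : ℕ := (j % n).toNat with hk
  have hk' : ((k : ℤ)) = j % n := Int.toNat_of_nonneg (Int.emod_nonneg _ (by positivity))
  have hjk : j = n * (j / n) + k := by rw [hk']; exact (Int.mul_ediv_add_emod j n).symm
  refine ⟨k, 2 * Real.pi / n * (j - x), ?_, ?_⟩
  · rw [abs_mul, abs_of_pos (by positivity), abs_sub_comm]
    calc 2 * Real.pi / n * |x - j| ≤ 2 * Real.pi / n * (1 / 2) := by
          gcongr
          exact abs_sub_round x
      _ = Real.pi / n := by ring
  · have h1 : conj u * w = (‖u‖ * ‖w‖ : ℝ) * Complex.exp (θ * Complex.I) := by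
      have := Complex.norm_mul_exp_arg_mul_I (conj u * w)
      rw [norm_mul, Complex.norm_conj] at this
      exact this.symm
    rw [ray, ← mul_assoc, h1, mul_assoc, ← Complex.exp_add]
    congr 1
    rw [Complex.exp_eq_exp_iff_exists_int]
    refine ⟨-(j / n), ?_⟩
    have hjC : (j : ℂ) = n * ((j / n : ℤ) : ℂ) + k := by exact_mod_cast congrArg (Int.cast : ℤ → ℂ) hjk
    have hxx : 2 * Real.pi / n * (j - x) = 2 * Real.pi / n * j + θ := by
      rw [hx]; field_simp; ring
    rw [hxx]
    generalize j / (n : ℤ) = q at *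
    push_cast
    rw [hjC]
    field_simp
    ring

theorem cos_pi_div_pos (hn : 3 ≤ n) : 0 < Real.cos (Real.pi / n) := by
  have hpi := Real.pi_pos
  have hn' : (3 : ℝ) ≤ n := by exact_mod_cast hn
  have h : Real.pi / n ≤ Real.pi / 3 := by gcongr
  exact Real.cos_pos_of_mem_Ioo ⟨by linarith [div_nonneg hpi.le (by linarith : (0 : ℝ) ≤ n)],
    by linarith⟩

theorem cos_pi_div_lt_one (hn : 3 ≤ n) : Real.cos (Real.pi / n) < 1 := by
  have hpi := Real.pi_pos
  have hn' : (3 : ℝ) ≤ n := by exact_mod_cast hn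
  rw [← Real.cos_zero]
  exact Real.cos_lt_cos_of_nonneg_of_le_pi le_rfl (div_le_self hpi.le (by linarith)) (by positivity)

theorem cos_pi_div_le_cos (hn : 0 < n) {φ : ℝ} (h : |φ| ≤ Real.pi / n) :
    Real.cos (Real.pi / n) ≤ Real.cos φ := by
  have hn' : (1 : ℝ) ≤ n := by exact_mod_cast hn
  rw [← Real.cos_abs φ]
  exact Real.cos_le_cos_of_nonneg_of_le_pi (abs_nonneg _) (div_le_self Real.pi_pos.le hn') h

theorem cos_pi_div_lt_cos (hn : 0 < n) {φ : ℝ} (h : |φ| < Real.pi / n) :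
    Real.cos (Real.pi / n) < Real.cos φ := by
  have hn' : (1 : ℝ) ≤ n := by exact_mod_cast hn
  rw [← Real.cos_abs φ]
  exact Real.cos_lt_cos_of_nonneg_of_le_pi (abs_nonneg _) (div_le_self Real.pi_pos.le hn') h

theorem cos_odd_mul_pi_div_le (hn : 0 < n) {m : ℤ} (hm : Odd m) :
    Real.cos (m * Real.pi / n) ≤ Real.cos (Real.pi / n) := by
  have hpi := Real.pi_pos
  have hn' : (0 : ℝ) < n := by positivity
  -- The balanced residue modulo `2n` of an odd number is nonzero, so `|r|π/n` lies between `π/n`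
  -- and `π`, where cosine decreases.
  obtain ⟨r, q, hr, hrn, hmr⟩ : ∃ r q : ℤ, r ≠ 0 ∧ |r| ≤ n ∧ m = r + q * (2 * n) := by
    refine ⟨Int.bmod m (2 * n), Int.bdiv m (2 * n), ?_, ?_, ?_⟩
    · intro h
      have := Int.dvd_of_bmod_eq_zero h
      have h2 : (2 : ℤ) ∣ m := (Dvd.intro (n : ℤ) (by push_cast; rfl)).trans this
      exact (Int.not_even_iff_odd.2 hm) (even_iff_two_dvd.2 h2)
    · have h1 := Int.le_bmod (x := m) (m := 2 * n) (by omega)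
      have h2 := Int.bmod_le (x := m) (m := 2 * n) (by omega)
      rw [abs_le]
      omega
    · have := Int.bmod_add_bdiv' m (2 * n)
      push_cast at this
      linarith
  have h1 : (m : ℝ) * Real.pi / n = r * Real.pi / n + q * (2 * Real.pi) := by
    rw [hmr]
    push_cast
    field_simp
  rw [h1, Real.cos_add_int_mul_two_pi, ← Real.cos_abs, abs_div, abs_mul, abs_of_pos hpi,
    abs_of_pos hn', ← Int.cast_abs]
  have hr1 : (1 : ℝ) ≤ (|r| : ℤ) := by exact_mod_cast Int.one_le_abs hr
  have hr2 : ((|r| : ℤ) : ℝ) ≤ n := by exact_mod_cast hrn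
  refine Real.cos_le_cos_of_nonneg_of_le_pi (by positivity) ?_ ?_
  · rw [div_le_iff₀ hn', mul_comm Real.pi]
    gcongr
  · gcongr
    nlinarith

/-- The angle between an edge normal and a vertex direction is an odd multiple of `π/n`. -/
theorem inner_edgeNormal_ray_le (hn : 0 < n) (j k : ℕ) :
    inner ℝ (edgeNormal n w k) (ray n w j) ≤ ‖w‖ ^ 2 * Real.cos (Real.pi / n) := by
  have h : conj (edgeNormal n w k) * ray n w j =
      (‖w‖ ^ 2 : ℝ) * Complex.exp ((((2 * (j : ℤ) - 2 * k - 1 : ℤ) : ℝ) * Real.pi / n : ℝ) *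
        Complex.I) := by
    have h1 : conj w * w = (‖w‖ ^ 2 : ℝ) := by
      rw [mul_comm, Complex.mul_conj, Complex.normSq_eq_norm_sq]
    rw [← h1, edgeNormal, ray, ray, map_mul, map_mul, ← Complex.exp_conj, ← Complex.exp_conj]
    simp only [map_mul, map_div₀, Complex.conj_ofReal, Complex.conj_I, map_ofNat, Complex.conj_natCast]
    rw [show ∀ a b d : ℂ, conj w * a * b * (w * d) = conj w * w * (a * b * d) by intros; ring,
      ← Complex.exp_add, ← Complex.exp_add]
    push_cast
    congr 2
    ring
  rw [Complex.inner, mul_comm (ray n w _), h, Complex.re_ofReal_mul, Complex.exp_ofReal_mul_I_re]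
  have : Odd (2 * (j : ℤ) - 2 * k - 1) := ⟨j - k - 1, by ring⟩
  gcongr
  exact cos_odd_mul_pi_div_le hn this

theorem inner_edgeNormal_sub_center_le (hn : 0 < n) {x : ℂ} (hx : x ∈ polygon n c w) (k : ℕ) :
    inner ℝ (edgeNormal n w k) (x - c) ≤ ‖w‖ ^ 2 * Real.cos (Real.pi / n) := by
  have hconv : Convex ℝ {x : ℂ | inner ℝ (edgeNormal n w k) x ≤
      ‖w‖ ^ 2 * Real.cos (Real.pi / n) + inner ℝ (edgeNormal n w k) c} :=
    convex_halfSpace_le (innerₛₗ ℝ (edgeNormal n w k)).isLinear _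
  have := convexHull_min ?_ hconv hx
  · rw [inner_sub_right]
    simpa using this
  · rintro _ ⟨j, rfl⟩
    have := inner_edgeNormal_ray_le (w := w) hn j k
    simp only [Set.mem_ofPred_eq, vertex_eq, inner_add_right]
    linarith

theorem vertex_mem_polygon (k : ℕ) : vertex n c w k ∈ polygon n c w :=
  subset_convexHull ℝ _ ⟨k, rfl⟩

theorem convex_polygon : Convex ℝ (polygon n c w) := convex_convexHull ℝ _

theorem edgeMidpoint_mem_polygon (k : ℕ) : edgeMidpoint n c w k ∈ polygon n c w :=
  convex_polygon.midpoint_mem (vertex_mem_polygon k) (vertex_mem_polygon (k + 1))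

theorem edgeMidpoint_mem_frontier (hn : 3 ≤ n) (hw : w ≠ 0) (k : ℕ) :
    edgeMidpoint n c w k ∈ frontier (polygon n c w) := by
  have hw' : 0 < ‖w‖ := norm_pos_iff.2 hw
  refine ⟨subset_closure (edgeMidpoint_mem_polygon k), fun h => ?_⟩
  obtain ⟨ε, hε, hball⟩ := Metric.mem_nhds_iff.1 (mem_interior_iff_mem_nhds.1 h)
  set δ : ℝ := ε / (2 * ‖w‖) with hδ
  have hδ' : 0 < δ := by positivity
  -- An interior point could be pushed outward along the normal, violating the half-plane inequality
  -- of its edge.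
  have hmem : edgeMidpoint n c w k + δ * edgeNormal n w k ∈ polygon n c w := by
    apply hball
    rw [mem_ball_iff_norm, add_sub_cancel_left, norm_mul, norm_edgeNormal, Complex.norm_real,
      Real.norm_of_nonneg hδ'.le, hδ]
    field_simp
    linarith
  have := inner_edgeNormal_sub_center_le (by omega) hmem k
  rw [edgeMidpoint_eq, add_assoc, add_sub_cancel_left, ← add_mul, ← Complex.ofReal_add,
    ← Complex.real_smul, real_inner_smul_right, real_inner_self_eq_norm_sq, norm_edgeNormal] at this
  nlinarith [mul_pos hδ' (pow_pos hw' 2)]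

theorem exists_inner_ray_ge (hn : 0 < n) (u w : ℂ) :
    ∃ k : ℕ, ‖u‖ * ‖w‖ * Real.cos (Real.pi / n) ≤ inner ℝ u (ray n w k) := by
  obtain ⟨k, φ, hφ, h⟩ := exists_conj_mul_ray hn u w
  refine ⟨k, ?_⟩
  rw [Complex.inner, mul_comm (ray n w _), h, Complex.re_ofReal_mul, Complex.exp_ofReal_mul_I_re]
  gcongr
  exact cos_pi_div_le_cos hn hφ

theorem exists_inner_edgeNormal_ge (hn : 0 < n) (u w : ℂ) :
    ∃ k : ℕ, ‖u‖ * ‖w‖ * Real.cos (Real.pi / n) ≤ inner ℝ u (edgeNormal n w k) := by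
  obtain ⟨k, h⟩ := exists_inner_ray_ge hn u
    (w * Complex.exp ((Real.pi / n : ℝ) * Complex.I))
  refine ⟨k, ?_⟩
  rw [norm_mul, Complex.norm_exp_ofReal_mul_I, mul_one] at h
  rwa [edgeNormal, ray, mul_right_comm w]

/-- A line separating `z` from the polygon has a normal `g`; some vertex reaches at least `‖g‖‖w‖
cos (π/n)` in that direction, beyond any point of the disc. -/
theorem ball_center_subset (hn : 0 < n) :
    Metric.ball c (‖w‖ * Real.cos (Real.pi / n)) ⊆ polygon n c w := by
  intro z hz
  by_contra hzP
  obtain ⟨f, u, hu, hf⟩ := geometric_hahn_banach_closed_point convex_polygon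
    (isClosed_polygon n c w) hzP
  set g := (InnerProductSpace.toDual ℝ ℂ).symm f with hg
  have hfg : ∀ x, f x = inner ℝ g x := fun x => by
    rw [hg, InnerProductSpace.toDual_symm_apply]
  obtain ⟨k, hk⟩ := exists_inner_ray_ge hn g w
  have h1 := hu _ (vertex_mem_polygon k)
  rw [hfg, vertex_eq, inner_add_right] at h1
  rw [hfg] at hf
  have h2 : inner ℝ g (z - c) ≤ ‖g‖ * ‖z - c‖ := real_inner_le_norm _ _
  rw [inner_sub_right] at h2
  have h3 := mul_le_mul_of_nonneg_left (mem_ball_iff_norm.1 hz).le (norm_nonneg g)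
  linarith

theorem le_dist_center_of_mem_frontier (hn : 0 < n) {z : ℂ} (hz : z ∈ frontier (polygon n c w)) :
    ‖w‖ * Real.cos (Real.pi / n) ≤ dist z c := by
  by_contra! h
  exact hz.2 (interior_mono (ball_center_subset hn) (by rwa [Metric.isOpen_ball.interior_eq]))

end RegularPolygon

/-! ### Discs touching the boundary at both ends of a diameter -/

section Width

open ComplexConjugate

variable {n : ℕ} {c w : ℂ}

/-- A line supporting `P` at `p` also supports the inscribed disc there, so it must be the tangent
to the disc. -/
theorem inner_sub_nonpos_of_ball_subset {P : Set ℂ} (hconv : Convex ℝ P) (hcl : IsClosed P)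
    {m p : ℂ} {r : ℝ} (hr : 0 < r) (hball : Metric.ball m r ⊆ P) (hp : p ∈ frontier P)
    (hpm : dist p m = r) {x : ℂ} (hx : x ∈ P) : inner ℝ (p - m) (x - p) ≤ 0 := by
  have hint : (interior P).Nonempty :=
    ⟨m, interior_mono hball (by simpa [Metric.isOpen_ball.interior_eq] using hr)⟩
  obtain ⟨f, hf0, hf⟩ := geometric_hahn_banach_of_nonempty_interior_point hconv hp.2 hint
  set g := (InnerProductSpace.toDual ℝ ℂ).symm f with hg
  have hfg : ∀ x, f x = inner ℝ g x := fun x => by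
    rw [hg, InnerProductSpace.toDual_symm_apply]
  have hg0 : 0 < ‖g‖ := by
    rw [norm_pos_iff, hg]
    simpa using hf0
  have hcball : Metric.closedBall m r ⊆ P := by
    rw [← closure_ball m hr.ne']
    exact closure_minimal hball hcl
  -- This is the point of the disc furthest in direction `g`. That it does not pass `p` forces
  -- equality in Cauchy–Schwarz, so `p - m` is parallel to `g`.
  have hmem : m + (r / ‖g‖) • g ∈ P := by
    apply hcball
    rw [mem_closedBall_iff_norm, add_sub_cancel_left, norm_smul, Real.norm_of_nonneg (by positivity),
      div_mul_cancel₀ _ hg0.ne']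
  have h1 := hf _ hmem
  rw [hfg, hfg, inner_add_right, real_inner_smul_right, real_inner_self_eq_norm_sq,
    show r / ‖g‖ * ‖g‖ ^ 2 = ‖g‖ * r by field_simp] at h1
  rw [dist_eq_norm] at hpm
  have h2 : inner ℝ g (p - m) = ‖g‖ * ‖p - m‖ := by
    refine le_antisymm (real_inner_le_norm _ _) ?_
    rw [inner_sub_right, hpm]
    linarith
  rw [inner_eq_norm_mul_iff_real, hpm] at h2
  have h3 : inner ℝ (‖g‖ • (p - m)) (x - p) ≤ 0 := by
    rw [← h2, real_inner_smul_left, inner_sub_right]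
    have := hf _ hx
    rw [hfg, hfg] at this
    nlinarith
  rw [real_inner_smul_left] at h3
  exact nonpos_of_mul_nonpos_right h3 hg0

/-- The ball is connected and misses the frontier, so it cannot meet both the interior and the
exterior. -/
theorem ball_subset_of_le_dist_frontier {P : Set ℂ} {m : ℂ} {r : ℝ} (hm : m ∈ P)
    (h : ∀ z ∈ frontier P, r ≤ dist m z) : Metric.ball m r ⊆ P := by
  intro z hz
  by_contra hzP
  have hr : 0 < r := dist_nonneg.trans_lt (Metric.mem_ball.1 hz)
  have hfr : ∀ y ∈ Metric.ball m r, y ∉ frontier P := fun y hy hyf => by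
    have := h y hyf
    rw [dist_comm] at this
    exact absurd (Metric.mem_ball.1 hy) (not_lt.2 this)
  obtain ⟨y, -, hy1, hy2⟩ := (convex_ball m r).isPreconnected (interior P) (closure P)ᶜ
    isOpen_interior isClosed_closure.isOpen_compl
    (fun y hy => by
      by_contra hy'
      rw [Set.mem_union, not_or, Set.notMem_compl_iff] at hy'
      exact hfr y hy ⟨hy'.2, hy'.1⟩)
    ⟨m, Metric.mem_ball_self hr, by
      by_contra hm'
      exact hfr m (Metric.mem_ball_self hr) ⟨subset_closure hm, hm'⟩⟩
    ⟨z, hz, fun hz' => hfr z hz ⟨hz', fun hzi => hzP (interior_subset hzi)⟩⟩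
  exact hy2 (interior_subset_closure hy1)

/-- Some edge normal is within `π/n` of `m - c`, and the disc must not cross that edge. The bound
yields both `r ≤` apothem and, when equality holds, `m = c`. -/
theorem dist_center_mul_cos_add_le (hn : 3 ≤ n) (hw : w ≠ 0) {m : ℂ} {r : ℝ} (hr : 0 < r)
    (hball : Metric.ball m r ⊆ polygon n c w) :
    ‖m - c‖ * Real.cos (Real.pi / n) + r ≤ ‖w‖ * Real.cos (Real.pi / n) := by
  have hw' : 0 < ‖w‖ := norm_pos_iff.2 hw
  obtain ⟨k, hk⟩ := exists_inner_edgeNormal_ge (n := n) (by omega) (m - c) w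
  have hcball : Metric.closedBall m r ⊆ polygon n c w := by
    rw [← closure_ball m hr.ne']
    exact closure_minimal hball (isClosed_polygon n c w)
  have hmem : m + (r / ‖w‖) • edgeNormal n w k ∈ polygon n c w := by
    apply hcball
    rw [mem_closedBall_iff_norm, add_sub_cancel_left, norm_smul, Real.norm_of_nonneg (by positivity),
      norm_edgeNormal, div_mul_cancel₀ _ hw'.ne']
  have h1 := inner_edgeNormal_sub_center_le (by omega) hmem k
  rw [add_sub_right_comm, inner_add_right, real_inner_smul_right, real_inner_self_eq_norm_sq,
    norm_edgeNormal, real_inner_comm,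
    show r / ‖w‖ * ‖w‖ ^ 2 = ‖w‖ * r by field_simp] at h1
  nlinarith

theorem edgeMidpoint_add_self (hn : 0 < n) (k : ℕ) :
    edgeMidpoint n c w (k + n) = edgeMidpoint n c w k := by
  rw [edgeMidpoint_eq, edgeMidpoint_eq, edgeNormal, edgeNormal, ray_add_self hn]

theorem edgeMidpoint_add_half (hn : 0 < n) (he : Even n) (k : ℕ) :
    edgeMidpoint n c w (k + n / 2) - c = -(edgeMidpoint n c w k - c) := by
  rw [edgeMidpoint_eq, edgeMidpoint_eq, edgeNormal, edgeNormal, ray_add_half hn he]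
  ring

theorem dist_edgeMidpoint_center (hn : 3 ≤ n) (k : ℕ) :
    dist (edgeMidpoint n c w k) c = ‖w‖ * Real.cos (Real.pi / n) := by
  rw [edgeMidpoint_eq, dist_eq_norm, add_sub_cancel_left, norm_mul, norm_edgeNormal,
    Complex.norm_real, Real.norm_of_nonneg (cos_pi_div_pos hn).le, mul_comm]

theorem even_and_eq_edgeMidpoint_of_le_dist (hn : 3 ≤ n) (hw : w ≠ 0) {p q : ℂ}
    (hp : p ∈ frontier (polygon n c w)) (hq : q ∈ frontier (polygon n c w)) (hpq : p ≠ q)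
    (h : ∀ z ∈ frontier (polygon n c w), dist p q / 2 ≤ dist (midpoint ℝ p q) z) :
    Even n ∧ ∃ k, p = edgeMidpoint n c w k ∧ q = edgeMidpoint n c w (k + n / 2) := by
  have hn0 : 0 < n := by omega
  have hnR : (0 : ℝ) < n := by positivity
  have hpi := Real.pi_pos
  have hw' : 0 < ‖w‖ := norm_pos_iff.2 hw
  set α := Real.pi / n with hα
  have hα0 : 0 < α := by positivity
  have hcos : 0 < Real.cos α := cos_pi_div_pos hn
  set m := midpoint ℝ p q with hm
  set r := dist p q / 2 with hr
  have hr0 : 0 < r := half_pos (dist_pos.2 hpq)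
  set u := q - m with hu
  have hpu : p - m = -u := by
    rw [hu, hm, midpoint_eq_smul_add, invOf_eq_inv, Complex.real_smul]
    push_cast
    ring
  have hpm : dist p m = r := by
    rw [hm, dist_left_midpoint, hr, Real.norm_ofNat]
    ring
  have hnu : ‖u‖ = r := by rw [← norm_neg, ← hpu, ← dist_eq_norm, hpm]
  have hqm : dist q m = r := by rw [dist_eq_norm, ← hnu]
  have hmP : m ∈ polygon n c w := convex_polygon.midpoint_mem
    ((isClosed_polygon n c w).frontier_subset hp) ((isClosed_polygon n c w).frontier_subset hq)
  have hball := ball_subset_of_le_dist_frontier hmP h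
  have hdr := dist_center_mul_cos_add_le hn hw hr0 hball
  have hupper : ∀ k, inner ℝ u (ray n w k) ≤ inner ℝ u (m - c) + r ^ 2 := by
    intro k
    have h1 := inner_sub_nonpos_of_ball_subset convex_polygon (isClosed_polygon n c w) hr0 hball hq
      hqm (vertex_mem_polygon k)
    rw [← hu, vertex_eq, show c + ray n w k - q = ray n w k - (m - c) - u by rw [hu]; ring,
      inner_sub_right, inner_sub_right, real_inner_self_eq_norm_sq, hnu] at h1
    linarith
  have hlower : ∀ k, inner ℝ u (m - c) - r ^ 2 ≤ inner ℝ u (ray n w k) := by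
    intro k
    have h1 := inner_sub_nonpos_of_ball_subset convex_polygon (isClosed_polygon n c w) hr0 hball hp
      hpm (vertex_mem_polygon k)
    rw [hpu, vertex_eq, show c + ray n w k - p = ray n w k - (m - c) + u by
      linear_combination -hpu, inner_neg_left, inner_add_right,
      inner_sub_right, real_inner_self_eq_norm_sq, hnu] at h1
    linarith
  have hra : r ≤ ‖w‖ * Real.cos α := by
    have : 0 ≤ ‖m - c‖ * Real.cos α := by positivity
    linarith
  obtain ⟨k, φ, hφ, hk⟩ := exists_conj_mul_ray hn0 u w
  rw [hnu] at hk
  have hinner : ∀ ψ : ℝ, ∀ z : ℂ, z = ray n w k * Complex.exp (ψ * Complex.I) →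
      inner ℝ u z = r * ‖w‖ * Real.cos (φ + ψ) := by
    intro ψ z hz
    rw [Complex.inner, hz, mul_comm, ← mul_assoc, hk, mul_assoc, ← Complex.exp_add, ← add_mul,
      ← Complex.ofReal_add, Complex.re_ofReal_mul, Complex.exp_ofReal_mul_I_re]
  have hk0 := hinner 0 (ray n w k) (by simp)
  rw [add_zero] at hk0
  -- All vertices lie in the strip, so their extent along `u`, scaled by `‖u‖ = r`, is at most
  -- `2r²`, and `r` is at most the apothem.
  have hsum : ∀ j, inner ℝ u (ray n w k) - inner ℝ u (ray n w j) ≤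
      r * ‖w‖ * (2 * Real.cos α) := by
    intro j
    have h1 := hupper k
    have h2 := hlower j
    nlinarith
  rcases Nat.even_or_odd n with he | ho
  · refine ⟨he, ?_⟩
    have h1 := hsum (k + n / 2)
    rw [ray_add_half hn0 he, inner_neg_right, hk0] at h1
    have h2 : Real.cos φ ≤ Real.cos α := by
      have : r * ‖w‖ * (2 * Real.cos φ) ≤ r * ‖w‖ * (2 * Real.cos α) := by linarith
      have := le_of_mul_le_mul_left this (by positivity)
      linarith
    have hφα : |φ| = α := by
      refine le_antisymm hφ ?_
      by_contra! hlt
      exact absurd (cos_pi_div_lt_cos hn0 hlt) (not_lt.2 h2)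
    have hcφ : Real.cos φ = Real.cos α := by rw [← Real.cos_abs, hφα]
    -- The opposite vertices `k` and `k + n / 2` must fit in the strip of width `2r`, which bounds
    -- `r` below by the apothem.
    have hra' : r = ‖w‖ * Real.cos α := by
      refine le_antisymm hra ?_
      have h3 := hupper k
      have h4 := hlower (k + n / 2)
      rw [ray_add_half hn0 he, inner_neg_right] at h4
      rw [hk0, hcφ] at h3 h4
      have : r * (‖w‖ * Real.cos α) ≤ r * r := by nlinarith
      exact le_of_mul_le_mul_left this hr0
    have hmc : m = c := by
      have h3 : ‖m - c‖ * Real.cos α ≤ 0 := by linarith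
      have h4 : ‖m - c‖ = 0 :=
        le_antisymm (nonpos_of_mul_nonpos_left h3 hcos) (norm_nonneg _)
      exact sub_eq_zero.1 (norm_eq_zero.1 h4)
    have huk : u = (Real.cos α : ℝ) * (ray n w k * Complex.exp ((-φ : ℝ) * Complex.I)) := by
      have h3 : u * conj u = (r ^ 2 : ℝ) := by
        rw [Complex.mul_conj, Complex.normSq_eq_norm_sq, hnu]
      have h4 : Complex.exp (φ * Complex.I) * Complex.exp ((-φ : ℝ) * Complex.I) = 1 := by
        rw [← Complex.exp_add]
        push_cast
        rw [← add_mul, add_neg_cancel, zero_mul, Complex.exp_zero]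
      have h5 : ((r * ‖w‖ : ℝ) : ℂ) ≠ 0 := by exact_mod_cast (by positivity : r * ‖w‖ ≠ 0)
      have h6 : (r : ℂ) = ‖w‖ * (Real.cos α : ℝ) := by exact_mod_cast hra'
      apply mul_left_cancel₀ h5
      push_cast at h3 h5 hk h6 h4 ⊢
      linear_combination (-(r : ℂ) * ‖w‖ * u) * h4 - (u * Complex.exp (-φ * Complex.I)) * hk
        + (ray n w k * Complex.exp (-φ * Complex.I)) * h3
        + (r * ray n w k * Complex.exp (-φ * Complex.I)) * h6
    -- The sign of `φ` decides which of the two edges at vertex `k` has its normal along `u`. The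
    -- preceding edge is written `k + (n - 1)` to stay in `ℕ`.
    have hq' : ∃ j, q = edgeMidpoint n c w j := by
      rcases (abs_eq hα0.le).1 hφα with hφ' | hφ'
      · refine ⟨k + (n - 1), ?_⟩
        rw [edgeMidpoint_eq, ← hα, edgeNormal, ray_add, show q = m + u by rw [hu]; ring, hmc, huk,
          mul_assoc, ← Complex.exp_add, hφ']
        congr 3
        rw [Complex.exp_eq_exp_iff_exists_int]
        refine ⟨-1, ?_⟩
        rw [hα]
        have hnC : (n : ℂ) ≠ 0 := by exact_mod_cast hn0.ne'
        rw [Nat.cast_sub (by omega)]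
        push_cast
        field_simp
        ring
      · refine ⟨k, ?_⟩
        rw [edgeMidpoint_eq, ← hα, edgeNormal, show q = m + u by rw [hu]; ring, hmc, huk, hφ',
          neg_neg]
    obtain ⟨j, hj⟩ := hq'
    refine ⟨j + n / 2, ?_, ?_⟩
    · have h3 := edgeMidpoint_add_half (c := c) (w := w) hn0 he j
      rw [← hj] at h3
      rw [hmc] at hu hpu
      linear_combination hpu - h3 - hu
    · rw [hj, add_assoc, ← two_mul, Nat.two_mul_div_two_of_even he, edgeMidpoint_add_self hn0]
  · exfalso
    have hray : ∀ s : ℕ, ∀ ψ : ℝ, 2 * Real.pi * s / n = ψ + Real.pi →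
        inner ℝ u (ray n w (k + s)) = - (r * ‖w‖ * Real.cos (φ + ψ)) := by
      intro s ψ hs
      rw [hinner (ψ + Real.pi) _ (by rw [ray_add, hs]), ← add_assoc, Real.cos_add_pi]
      ring
    -- Here `ψ` is the angle of a second vertex measured from `-u`. Both cosines are at least `cos
    -- α`, so one strict inequality already overfills the strip.
    have hstrict : ∀ ψ : ℝ, |ψ| ≤ α → Real.cos α < Real.cos φ ∨ Real.cos α < Real.cos ψ →
        (∃ s : ℕ, 2 * Real.pi * s / n = ψ - φ + Real.pi) → False := by
      rintro ψ hψ hlt ⟨s, hs⟩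
      have h1 := hsum (k + s)
      rw [hray s (ψ - φ) hs, hk0, add_sub_cancel] at h1
      have h2 : r * ‖w‖ * (Real.cos φ + Real.cos ψ) ≤ r * ‖w‖ * (2 * Real.cos α) := by linarith
      have h3 := le_of_mul_le_mul_left h2 (by positivity)
      have h4 := cos_pi_div_le_cos hn0 hφ
      have h5 := cos_pi_div_le_cos hn0 hψ
      rcases hlt with h | h <;> linarith
    have hlt : ∀ ψ : ℝ, (|φ| = α → ψ = 0) →
        Real.cos α < Real.cos φ ∨ Real.cos α < Real.cos ψ := by
      intro ψ hψ
      rcases hφ.lt_or_eq with h1 | h1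
      · exact Or.inl (cos_pi_div_lt_cos hn0 h1)
      · rw [hψ h1, Real.cos_zero]
        exact Or.inr (cos_pi_div_lt_one hn)
    obtain ⟨l, hl⟩ := ho
    have hlR : (n : ℝ) = 2 * l + 1 := by exact_mod_cast hl
    have hφ' := abs_le.1 hφ
    -- With `n = 2l + 1`, advancing by `l` or `l + 1` vertices turns by `π - α` or `π + α`. The sign
    -- of `φ` selects the one keeping `|ψ| ≤ α`; if `|φ| = α`, that vertex is exactly in direction
    -- `-u`.
    rcases le_total 0 φ with h0 | h0
    · rw [abs_of_nonneg h0] at hlt hφ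
      refine hstrict (φ - α) (abs_le.2 ⟨by linarith, by linarith⟩)
        (hlt _ fun h1 => by linarith) ⟨l, ?_⟩
      rw [hα]
      field_simp
      rw [hlR]
      ring
    · rw [abs_of_nonpos h0] at hlt hφ
      refine hstrict (φ + α) (abs_le.2 ⟨by linarith, by linarith⟩)
        (hlt _ fun h1 => by linarith) ⟨l + 1, ?_⟩
      rw [hα]
      push_cast
      field_simp
      rw [hlR]
      ring

end Width

/-! ### A half-geodesic runs around a doubled segment -/

section HalfGeodesics

open Set

variable {n : ℕ} {c w : ℂ} {γ : Circ → DoubledNGon n c w} {v : ℝ}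

theorem continuous_of_dist_eq {X : Type*} [MetricSpace X] {γ : Circ → X} {v : ℝ} (hv : 0 < v)
    (H : ∀ s t : ℝ, |s - t| ≤ Real.pi → dist (γ (s : Circ)) (γ (t : Circ)) = v * |s - t|) :
    Continuous fun t : ℝ => γ (t : Circ) := by
  refine Metric.continuous_iff.2 fun t ε hε => ⟨min Real.pi (ε / v), by positivity, fun s hs => ?_⟩
  rw [Real.dist_eq] at hs
  rw [H s t (hs.le.trans (min_le_left _ _)), mul_comm, ← lt_div_iff₀ hv]
  exact hs.trans_le (min_le_right _ _)

/-- The two faces are closed, cover the space and meet only in the boundary, so a connected piece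
avoiding the boundary stays in one face. -/
theorem exists_forall_isFacePoint {f : ℝ → DoubledNGon n c w} (hf : Continuous f) {s : Set ℝ}
    (hs : IsPreconnected s)
    (h : ∀ x ∈ s, ∀ p ∈ frontier (polygon n c w), ∀ i, ¬ IsFacePoint i p (f x)) :
    ∃ i, ∀ x ∈ s, ∃ z, IsFacePoint i z (f x) := by
  by_contra! hno
  have hno' : ∀ i, (s ∩ {x : ℝ | ∃ z, IsFacePoint (!i) z (f x)}).Nonempty := by
    intro i
    obtain ⟨x, hx, hxn⟩ := hno i
    obtain ⟨j, z, hz⟩ := exists_isFacePoint (f x)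
    by_cases hj : j = i
    · subst hj
      exact absurd hz (hxn z)
    · obtain rfl : j = !i := Bool.eq_not.2 hj
      exact ⟨x, hx, z, hz⟩
  obtain ⟨x, hx, ⟨z, hz⟩, ⟨z', hz'⟩⟩ := isPreconnected_closed_iff.1 hs _ _
    ((isClosed_setOf_isFacePoint false).preimage hf) ((isClosed_setOf_isFacePoint true).preimage hf)
    (fun x _ => by
      obtain ⟨j, z, hz⟩ := exists_isFacePoint (f x)
      cases j
      · exact Or.inl ⟨z, hz⟩
      · exact Or.inr ⟨z, hz⟩) (hno' true) (hno' false)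
  exact h x hx z (hz.mem_frontier hz') _ hz

/-- In one convex face the points at parameters `π/2` and `-π/2` would both be the unique Euclidean
midpoint of the same antipodal pair, although they are at distance `vπ`. -/
theorem exists_mem_frontier_of_dist_eq (hv : 0 < v)
    (H : ∀ s t : ℝ, |s - t| ≤ Real.pi → dist (γ (s : Circ)) (γ (t : Circ)) = v * |s - t|) :
    ∃ t : ℝ, ∃ p ∈ frontier (polygon n c w), ∀ i, IsFacePoint i p (γ (t : Circ)) := by
  have hpi := Real.pi_pos
  by_contra! hno
  obtain ⟨i, hall⟩ := exists_forall_isFacePoint (continuous_of_dist_eq hv H) isPreconnected_univ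
    (fun t _ p hp i hi => by
      obtain ⟨j, hj⟩ := hno t p hp
      exact hj (hi.of_mem_frontier hp j))
  replace hall := fun t => hall t (mem_univ t)
  choose z hz using hall
  have hd : ∀ s t : ℝ, |s - t| ≤ Real.pi → dist (z s) (z t) = v * |s - t| := fun s t hst => by
    rw [← (hz s).dist_eq (hz t), H s t hst]
  have hzπ : z Real.pi = z (-Real.pi) := by
    have := coe_add_pi_eq_coe_sub_pi 0
    rw [zero_add, zero_sub] at this
    have h1 := hz Real.pi
    rw [this] at h1
    exact h1.eq (hz _)
  have key : ∀ e : ℝ, |e| = Real.pi → z (e / 2) = midpoint ℝ (z 0) (z e) := by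
    intro e he
    have h0 : |0 - e| = Real.pi := by rw [zero_sub, abs_neg, he]
    have h1 : |0 - e / 2| = Real.pi / 2 := by rw [zero_sub, abs_neg, abs_div, he, abs_two]
    have h2 : |e / 2 - e| = Real.pi / 2 := by
      rw [show e / 2 - e = 0 - e / 2 by ring, h1]
    have h3 := hd 0 e h0.le
    have h4 := hd 0 (e / 2) (by linarith)
    have h5 := hd (e / 2) e (by linarith)
    apply eq_midpoint_of_dist_eq_half
    · rw [h3, h4, h0, h1]
      ring
    · rw [h3, h5, h0, h2]
      ring
  have h1 := key Real.pi (abs_of_pos hpi)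
  have h2 := key (-Real.pi) (by rw [abs_neg, abs_of_pos hpi])
  rw [← hzπ, ← h1] at h2
  have h3 := hd (-Real.pi / 2) (Real.pi / 2)
  rw [h2, dist_self, show -Real.pi / 2 - Real.pi / 2 = -Real.pi by ring, abs_neg,
    abs_of_pos hpi] at h3
  nlinarith [h3 le_rfl]

/-- As `p` belongs to both faces, distances from it are Euclidean, while the planar distance from
`z` to `q` can only be smaller than on the double. This forces equality in the triangle inequality.
The sign `e` selects one of the two arcs from `p`. -/
theorem eq_lineMap_of_dist_eq
    (H : ∀ s t : ℝ, |s - t| ≤ Real.pi → dist (γ (s : Circ)) (γ (t : Circ)) = v * |s - t|)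
    {t₀ : ℝ} {p q : ℂ} (hp : ∀ i, IsFacePoint i p (γ (t₀ : Circ))) {j : Bool} {e : ℝ}
    (he : |e| = 1) (hq : IsFacePoint j q (γ ((t₀ + e * Real.pi : ℝ) : Circ))) {x : ℝ}
    (hx : x ∈ Icc (0 : ℝ) 1) {i : Bool} {z : ℂ}
    (hz : IsFacePoint i z (γ ((t₀ + e * (Real.pi * x) : ℝ) : Circ))) :
    z = AffineMap.lineMap p q x := by
  have hpi := Real.pi_pos
  have hd1 : dist p q = v * Real.pi := by
    rw [← (hp j).dist_eq hq, H] <;> rw [sub_add_cancel_left, abs_neg, abs_mul, he, one_mul,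
      abs_of_pos hpi]
  have hd2 : dist p z = v * (Real.pi * x) := by
    have h : |t₀ - (t₀ + e * (Real.pi * x))| = Real.pi * x := by
      rw [sub_add_cancel_left, abs_neg, abs_mul, he, one_mul,
        abs_of_nonneg (mul_nonneg hpi.le hx.1)]
    rw [← (hp i).dist_eq hz, H] <;> rw [h]
    nlinarith [hx.2]
  have hd3 : dist z q ≤ v * (Real.pi * (1 - x)) := by
    have h : |t₀ + e * (Real.pi * x) - (t₀ + e * Real.pi)| = Real.pi * (1 - x) := by
      rw [show t₀ + e * (Real.pi * x) - (t₀ + e * Real.pi) = -(e * (Real.pi * (1 - x))) by ring,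
        abs_neg, abs_mul, he, one_mul, abs_of_nonneg (mul_nonneg hpi.le (by linarith [hx.2]))]
    refine (hz.dist_le hq).trans ?_
    rw [H] <;> rw [h]
    nlinarith [hx.1]
  have hd4 := dist_triangle p z q
  apply eq_lineMap_of_dist_eq_mul_of_dist_eq_mul <;> rw [hd1] <;> linarith

theorem exists_runsAround_of_dist_eq (hv : 0 < v)
    (H : ∀ s t : ℝ, |s - t| ≤ Real.pi → dist (γ (s : Circ)) (γ (t : Circ)) = v * |s - t|) :
    ∃ p ∈ frontier (polygon n c w), ∃ q ∈ frontier (polygon n c w), RunsAround γ p q := by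
  have hpi := Real.pi_pos
  have hcont := continuous_of_dist_eq hv H
  obtain ⟨t₀, p, hpf, hp⟩ := exists_mem_frontier_of_dist_eq hv H
  obtain ⟨j₀, q, hq⟩ := exists_isFacePoint (γ ((t₀ + 1 * Real.pi : ℝ) : Circ))
  have hq' : IsFacePoint j₀ q (γ ((t₀ + (-1) * Real.pi : ℝ) : Circ)) := by
    convert! hq using 2
    rw [one_mul, coe_add_pi_eq_coe_sub_pi]
    congr 1
    ring
  have hline1 := fun {x} (hx : x ∈ Icc (0 : ℝ) 1) {i} {z} =>
    eq_lineMap_of_dist_eq H hp abs_one hq hx (i := i) (z := z)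
  have hline2 := fun {x} (hx : x ∈ Icc (0 : ℝ) 1) {i} {z} =>
    eq_lineMap_of_dist_eq H hp (by simp : |(-1 : ℝ)| = 1) hq' hx (i := i) (z := z)
  have hne : ∀ x ∈ Ioo (0 : ℝ) 1, γ ((t₀ + 1 * (Real.pi * x) : ℝ) : Circ) ≠
      γ ((t₀ + (-1) * (Real.pi * x) : ℝ) : Circ) := by
    intro x hx heq
    have hx0 := mul_pos hpi hx.1
    have hx1 := mul_pos hpi (sub_pos.2 hx.2)
    -- The metric identity needs a parameter gap of at most `π`; past the middle, the shorter way
    -- between the two parameters goes through the antipode, with gap `2π(1 - x)`.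
    rcases le_total x (1 / 2) with h | h
    · have hab : |t₀ + 1 * (Real.pi * x) - (t₀ + (-1) * (Real.pi * x))| = 2 * (Real.pi * x) := by
        rw [← abs_of_pos (mul_pos two_pos hx0)]
        congr 1
        ring
      have := H _ _ (hab.trans_le (by nlinarith))
      rw [heq, dist_self, hab] at this
      nlinarith [mul_pos hv hx0]
    · have hab : |t₀ + 1 * (Real.pi * x) - (t₀ + (-1) * (Real.pi * x) + 2 * Real.pi)| =
          2 * (Real.pi * (1 - x)) := by
        rw [abs_sub_comm, ← abs_of_pos (mul_pos two_pos hx1)]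
        congr 1
        ring
      have := H _ _ (hab.trans_le (by nlinarith))
      rw [coe_add_two_pi, heq, dist_self, hab] at this
      nlinarith [mul_pos hv hx1]
  have hopp : ∀ x ∈ Ioo (0 : ℝ) 1, ∀ i z, IsFacePoint i z (γ ((t₀ + 1 * (Real.pi * x) : ℝ) : Circ)) →
      IsFacePoint (!i) z (γ ((t₀ + (-1) * (Real.pi * x) : ℝ) : Circ)) := by
    intro x hx i z hz
    obtain ⟨j, z', hz'⟩ := exists_isFacePoint (γ ((t₀ + (-1) * (Real.pi * x) : ℝ) : Circ))
    obtain rfl : z = z' := (hline1 (Ioo_subset_Icc_self hx) hz).trans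
      (hline2 (Ioo_subset_Icc_self hx) hz').symm
    by_cases hj : j = i
    · subst hj
      exact absurd (hz.ext hz') (hne x hx)
    · obtain rfl : j = !i := Bool.eq_not.2 hj
      exact hz'
  have hcl : ∀ i, ∀ e : ℝ,
      IsClosed {x : ℝ | ∃ z, IsFacePoint i z (γ ((t₀ + e * (Real.pi * x) : ℝ) : Circ))} := fun i e =>
    (isClosed_setOf_isFacePoint i).preimage (hcont.comp (by fun_prop :
      Continuous fun x : ℝ => t₀ + e * (Real.pi * x)))
  obtain ⟨i, hi⟩ := exists_forall_isFacePoint (hcont.comp (by fun_prop :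
      Continuous fun x : ℝ => t₀ + 1 * (Real.pi * x))) (isPreconnected_Ioo (a := (0 : ℝ)) (b := 1))
    (fun x hx p hp i hi => hne x hx
      ((hi.of_mem_frontier hp _).ext (hopp x hx _ _ (hi.of_mem_frontier hp true))))
  have hIcc : closure (Ioo (0 : ℝ) 1) = Icc 0 1 := closure_Ioo zero_ne_one
  have h1 : ∀ x ∈ Icc (0 : ℝ) 1,
      IsFacePoint i (AffineMap.lineMap p q x) (γ ((t₀ + 1 * (Real.pi * x) : ℝ) : Circ)) := by
    intro x hx
    obtain ⟨z, hz⟩ := closure_minimal hi (hcl i 1) (hIcc ▸ hx)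
    rwa [← hline1 hx hz]
  have h2 : ∀ x ∈ Icc (0 : ℝ) 1,
      IsFacePoint (!i) (AffineMap.lineMap p q x) (γ ((t₀ + (-1) * (Real.pi * x) : ℝ) : Circ)) := by
    intro x hx
    obtain ⟨z, hz⟩ := closure_minimal (fun x hx => by
      obtain ⟨z, hz⟩ := hi x hx
      exact ⟨z, hopp x hx i z hz⟩) (hcl (!i) (-1)) (hIcc ▸ hx)
    rwa [← hline2 hx hz]
  have hqf : q ∈ frontier (polygon n c w) := by
    have h3 := h1 1 (by simp)
    have h4 := h2 1 (by simp)
    have h5 : ((t₀ + (-1) * (Real.pi * 1) : ℝ) : Circ) = ((t₀ + 1 * (Real.pi * 1) : ℝ) : Circ) := by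
      rw [mul_one, one_mul, coe_add_pi_eq_coe_sub_pi]
      congr 1
      ring
    rw [h5] at h4
    rw [AffineMap.lineMap_apply_one] at h3 h4
    exact h3.mem_frontier h4
  have hback : ∀ x : ℝ, x ∈ Icc (0 : ℝ) 1 → ∀ y : ℝ, (y : Circ) =
      ((t₀ + (-1) * (Real.pi * (1 - x)) : ℝ) : Circ) →
      IsFacePoint (!i) (AffineMap.lineMap q p x) (γ (y : Circ)) := by
    intro x hx y hy
    rw [hy, ← AffineMap.lineMap_apply_one_sub]
    exact h2 (1 - x) ⟨by linarith [hx.2], by linarith [hx.1]⟩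
  have hfwd : ∀ x : ℝ, x ∈ Icc (0 : ℝ) 1 → ∀ y : ℝ, (y : Circ) =
      ((t₀ + 1 * (Real.pi * x) : ℝ) : Circ) →
      IsFacePoint i (AffineMap.lineMap p q x) (γ (y : Circ)) := by
    intro x hx y hy
    rw [hy]
    exact h1 x hx
  -- `RunsAround` starts in face `false`. If the arc leaving `p` is in face `true`, the curve is
  -- read from `q` instead, with the base parameter moved back by `π`.
  cases i
  · refine ⟨p, hpf, q, hqf, t₀, fun x hx => ⟨hfwd x hx _ ?_, hback x hx _ ?_⟩⟩
    · rw [one_mul]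
    · rw [← coe_add_two_pi (t₀ + -1 * (Real.pi * (1 - x)))]
      congr 1
      ring
  · refine ⟨q, hqf, p, hpf, t₀ - Real.pi, fun x hx => ⟨hback x hx _ ?_, hfwd x hx _ ?_⟩⟩
    · congr 1
      ring
    · congr 1
      ring

end HalfGeodesics

/-! ### Curves around a doubled segment: existence, uniqueness, minimality -/

section RunsAround

open Set

variable {n : ℕ} {c w p q : ℂ} {γ δ : Circ → DoubledNGon n c w}

theorem coe_add_int_mul_two_pi (t : ℝ) (k : ℤ) : ((t + k * (2 * Real.pi) : ℝ) : Circ) = t := by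
  rw [← zsmul_eq_mul, AddCircle.coe_add, AddCircle.coe_zsmul, AddCircle.coe_period, smul_zero,
    add_zero]

/-- Unrolling the curve to the line treats both faces alike: each unit interval is a segment in one
face, and the antipodes trace the reversed segment in the other. -/
theorem RunsAround.exists_isFacePoint_int (h : RunsAround γ p q) :
    ∃ s : ℝ, ∀ k : ℤ, ∃ i, ∃ a b, (a = p ∧ b = q ∨ a = q ∧ b = p) ∧ ∀ x ∈ Icc (0 : ℝ) 1,
      IsFacePoint i (AffineMap.lineMap a b x) (γ ((s + Real.pi * (k + x) : ℝ) : Circ)) ∧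
      IsFacePoint (!i) (AffineMap.lineMap b a x) (γ ((s + Real.pi * (k + x + 1) : ℝ) : Circ)) := by
  obtain ⟨s, hs⟩ := h
  refine ⟨s, fun k => ?_⟩
  obtain ⟨l, rfl | rfl⟩ := Int.even_or_odd' k
  · refine ⟨false, p, q, Or.inl ⟨rfl, rfl⟩, fun x hx => ?_⟩
    convert! hs x hx using 3
    · rw [← coe_add_int_mul_two_pi (s + Real.pi * x) l]
      congr 1
      push_cast
      ring
    · rw [← coe_add_int_mul_two_pi (s + Real.pi + Real.pi * x) l]
      congr 1
      push_cast
      ring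
  · refine ⟨true, q, p, Or.inr ⟨rfl, rfl⟩, fun x hx => ?_⟩
    convert! (hs x hx).symm using 3
    · rw [← coe_add_int_mul_two_pi (s + Real.pi + Real.pi * x) l]
      congr 1
      push_cast
      ring
    · rw [← coe_add_int_mul_two_pi (s + Real.pi * x) (l + 1)]
      congr 1
      push_cast
      ring

/-- Antipodal points have planar positions with sum `p + q`, so any path between them through a
boundary point `z` has length at least `2|m - z| ≥ |p - q|`. With the Lipschitz bound this fixes all
shorter distances. -/
theorem RunsAround.isHalfGeodesic (h : RunsAround γ p q) (hpq : p ≠ q)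
    (hfr : ∀ z ∈ frontier (polygon n c w), dist p q / 2 ≤ dist (midpoint ℝ p q) z) :
    IsHalfGeodesic γ := by
  have hpi := Real.pi_pos
  have hD : 0 < dist p q := dist_pos.2 hpq
  obtain ⟨s, hs⟩ := h.exists_isFacePoint_int
  set g : ℝ → DoubledNGon n c w := fun u => γ ((s + Real.pi * u : ℝ) : Circ) with hg
  have hpiece : ∀ (k : ℤ) (u u' : ℝ), k ≤ u → u ≤ u' → u' ≤ k + 1 →
      dist (g u) (g u') = dist p q * (u' - u) := by
    intro k u u' h1 h2 h3
    obtain ⟨i, a, b, hab, hi⟩ := hs k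
    have hu := (hi (u - k) ⟨by linarith, by linarith⟩).1
    have hu' := (hi (u' - k) ⟨by linarith, by linarith⟩).1
    rw [add_sub_cancel] at hu hu'
    have hdab : dist a b = dist p q := by
      rcases hab with ⟨rfl, rfl⟩ | ⟨rfl, rfl⟩
      · rfl
      · exact dist_comm _ _
    rw [hg, hu.dist_eq hu', dist_lineMap_lineMap, hdab, dist_comm, Real.dist_eq, sub_sub_sub_cancel_right,
      abs_of_nonneg (sub_nonneg.2 h2), mul_comm]
  have hlip : ∀ u u' : ℝ, u ≤ u' → u' ≤ u + 1 → dist (g u) (g u') ≤ dist p q * (u' - u) := by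
    intro u u' h1 h2
    have h3 := Int.floor_le u
    have h4 := (Int.lt_floor_add_one u).le
    rcases le_total u' (⌊u⌋ + 1) with h5 | h5
    · exact (hpiece ⌊u⌋ u u' h3 h1 h5).le
    · have h6 := hpiece ⌊u⌋ u (⌊u⌋ + 1) h3 h4 le_rfl
      have h7 := hpiece (⌊u⌋ + 1) (⌊u⌋ + 1) u' (by push_cast; exact le_rfl) h5
        (by push_cast; linarith)
      have h8 := dist_triangle (g u) (g (⌊u⌋ + 1)) (g u')
      linarith
  have hanti : ∀ u, dist p q ≤ dist (g u) (g (u + 1)) := by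
    intro u
    obtain ⟨i, a, b, hab, hi⟩ := hs ⌊u⌋
    obtain ⟨h1, h2⟩ := hi (u - ⌊u⌋) ⟨by linarith [Int.floor_le u], by linarith [Int.lt_floor_add_one u]⟩
    rw [add_sub_cancel] at h1 h2
    refine h1.le_dist h2 fun z hz => ?_
    have h3 := hfr z hz
    have h4 : AffineMap.lineMap a b (u - ⌊u⌋) + AffineMap.lineMap b a (u - ⌊u⌋) = p + q := by
      simp only [AffineMap.lineMap_apply_module']
      rcases hab with ⟨rfl, rfl⟩ | ⟨rfl, rfl⟩ <;> module
    have h5 : 2 * dist (midpoint ℝ p q) z =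
        ‖(AffineMap.lineMap a b (u - ⌊u⌋) - z) + (AffineMap.lineMap b a (u - ⌊u⌋) - z)‖ := by
      rw [← Real.norm_two, dist_eq_norm, ← norm_smul, midpoint_eq_smul_add, ← h4, smul_sub,
        smul_smul, mul_invOf_self, one_smul, two_smul]
      congr 1
      ring
    have h6 := norm_add_le (AffineMap.lineMap a b (u - ⌊u⌋) - z)
      (AffineMap.lineMap b a (u - ⌊u⌋) - z)
    rw [← dist_eq_norm, ← dist_eq_norm] at h6
    linarith
  have heq : ∀ u u' : ℝ, u ≤ u' → u' ≤ u + 1 → dist (g u) (g u') = dist p q * (u' - u) := by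
    intro u u' h1 h2
    refine le_antisymm (hlip u u' h1 h2) ?_
    have h3 := hanti u
    have h4 := hlip u' (u + 1) h2 (by linarith)
    have h5 := dist_triangle (g u) (g u') (g (u + 1))
    linarith
  have hgt : ∀ t : ℝ, γ (t : Circ) = g ((t - s) / Real.pi) := by
    intro t
    rw [hg]
    congr 2
    field_simp
    ring
  have key : ∀ t t' : ℝ, t ≤ t' → t' - t ≤ Real.pi →
      dist (γ (t : Circ)) (γ (t' : Circ)) = dist p q / Real.pi * (t' - t) := by
    intro t t' h1 h2
    rw [hgt, hgt, heq]
    · field_simp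
      ring
    · gcongr
    · rw [div_add_one hpi.ne']
      gcongr
      linarith
  refine isHalfGeodesic_iff.2 ⟨dist p q / Real.pi, by positivity, fun t t' htt => ?_⟩
  rcases le_total t t' with h | h
  · rw [abs_sub_comm, abs_of_nonneg (sub_nonneg.2 h)] at htt ⊢
    exact key t t' h htt
  · rw [abs_of_nonneg (sub_nonneg.2 h)] at htt ⊢
    rw [dist_comm]
    exact key t' t h htt

theorem IsHalfGeodesic.exists_runsAround (h : IsHalfGeodesic γ) :
    ∃ p ∈ frontier (polygon n c w), ∃ q ∈ frontier (polygon n c w), RunsAround γ p q ∧ p ≠ q ∧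
      ∀ z ∈ frontier (polygon n c w), dist p q / 2 ≤ dist (midpoint ℝ p q) z := by
  have hpi := Real.pi_pos
  obtain ⟨v, hv, H⟩ := isHalfGeodesic_iff.1 h
  obtain ⟨p, hp, q, hq, s, hs⟩ := exists_runsAround_of_dist_eq hv H
  have h0 := (hs 0 (by simp)).1
  have h1 := (hs 1 (by simp)).1
  -- At this parameter both antipodal points lie over the midpoint of `pq`, so their distance is at
  -- most twice the distance from that midpoint to any boundary point.
  have h2 := hs (1 / 2) (by constructor <;> norm_num)
  have hd : dist p q = v * Real.pi := by
    rw [AffineMap.lineMap_apply_zero] at h0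
    rw [AffineMap.lineMap_apply_one] at h1
    have h3 : |s + Real.pi * 0 - (s + Real.pi * 1)| = Real.pi := by
      rw [show s + Real.pi * 0 - (s + Real.pi * 1) = -Real.pi by ring, abs_neg, abs_of_pos hpi]
    rw [← h0.dist_eq h1, H _ _ h3.le, h3]
  refine ⟨p, hp, q, hq, ⟨s, hs⟩, ?_, fun z hz => ?_⟩
  · rw [← dist_pos, hd]
    positivity
  · have h3 : |s + Real.pi * (1 / 2) - (s + Real.pi + Real.pi * (1 / 2))| = Real.pi := by
      rw [show s + Real.pi * (1 / 2) - (s + Real.pi + Real.pi * (1 / 2)) = -Real.pi by ring, abs_neg,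
        abs_of_pos hpi]
    have h4 := h2.1.dist_le_add h2.2 hz
    rw [lineMap_one_half, lineMap_one_half, midpoint_comm q, H _ _ h3.le, h3] at h4
    linarith

theorem exists_runsAround (hp : p ∈ frontier (polygon n c w)) (hq : q ∈ frontier (polygon n c w)) :
    ∃ γ : Circ → DoubledNGon n c w, RunsAround γ p q := by
  have hpi := Real.pi_pos
  have hpP := (isClosed_polygon n c w).frontier_subset hp
  have hqP := (isClosed_polygon n c w).frontier_subset hq
  have hmem : ∀ {a b : ℂ}, a ∈ polygon n c w → b ∈ polygon n c w → ∀ x ∈ Icc (0 : ℝ) 1,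
      AffineMap.lineMap a b x ∈ polygon n c w := fun ha hb x hx =>
    convex_polygon.lineMap_mem ha hb hx
  have hf : ∀ y : ℝ, ∃ P : DoubledNGon n c w,
      (y ∈ Icc 0 Real.pi → IsFacePoint false (AffineMap.lineMap p q (y / Real.pi)) P) ∧
      (y ∈ Icc Real.pi (2 * Real.pi) →
        IsFacePoint true (AffineMap.lineMap q p ((y - Real.pi) / Real.pi)) P) := by
    intro y
    rcases lt_trichotomy y Real.pi with h | rfl | h
    · by_cases h0 : 0 ≤ y
      · have := isFacePoint_face (i := false) (hmem hpP hqP (y / Real.pi)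
          ⟨by positivity, (div_le_one hpi).2 h.le⟩)
        exact ⟨_, fun _ => this, fun h' => absurd h'.1 (not_le.2 h)⟩
      · exact ⟨face n c w false ⟨p, hpP⟩, fun h' => absurd h'.1 h0, fun h' => absurd h'.1 (not_le.2 h)⟩
    -- At `y = π` both prescriptions apply; they agree because `q` is a boundary point. Outside `[0,
    -- 2π]` the value is arbitrary.
    · rw [div_self hpi.ne', sub_self, zero_div, AffineMap.lineMap_apply_one,
        AffineMap.lineMap_apply_zero]
      have := isFacePoint_face (i := false) hqP
      exact ⟨_, fun _ => this, fun _ => this.of_mem_frontier hq true⟩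
    · by_cases h0 : y ≤ 2 * Real.pi
      · have := isFacePoint_face (i := true) (hmem hqP hpP ((y - Real.pi) / Real.pi)
          ⟨div_nonneg (by linarith) hpi.le, (div_le_one hpi).2 (by linarith)⟩)
        exact ⟨_, fun h' => absurd h'.2 (not_le.2 h), fun _ => this⟩
      · exact ⟨face n c w false ⟨p, hpP⟩, fun h' => absurd h'.2 (not_le.2 h),
          fun h' => absurd h'.2 h0⟩
  choose f hf1 hf2 using hf
  have : Fact (0 < 2 * Real.pi) := ⟨by positivity⟩
  have hper : ∀ y ∈ Ico (0 : ℝ) (2 * Real.pi),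
      AddCircle.liftIco (2 * Real.pi) 0 f (y : Circ) = f y := fun y hy =>
    AddCircle.liftIco_coe_apply ⟨hy.1, by linarith [hy.2]⟩
  refine ⟨AddCircle.liftIco (2 * Real.pi) 0 f, 0, fun t ht => ?_⟩
  have ht0 := mul_nonneg hpi.le ht.1
  have ht1 := mul_le_of_le_one_right hpi.le ht.2
  simp only [zero_add]
  refine ⟨?_, ?_⟩
  · rw [hper _ ⟨ht0, by linarith⟩]
    have := hf1 (Real.pi * t) ⟨ht0, ht1⟩
    rwa [mul_div_cancel_left₀ _ hpi.ne'] at this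
  · rcases ht.2.lt_or_eq with h | rfl
    · have h' : Real.pi * t < Real.pi := mul_lt_of_lt_one_right hpi h
      rw [hper _ ⟨by linarith, by linarith⟩]
      have := hf2 (Real.pi + Real.pi * t) ⟨by linarith, by linarith⟩
      rwa [add_sub_cancel_left, mul_div_cancel_left₀ _ hpi.ne'] at this
    -- The return to the start is read off at parameter `0`, in face `false`; since `p` is a
    -- boundary point it lies in face `true` as well.
    · have h0 : ((Real.pi + Real.pi * 1 : ℝ) : Circ) = ((0 : ℝ) : Circ) := by
        rw [← coe_add_two_pi 0]
        congr 1
        ring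
      rw [h0, hper 0 ⟨le_rfl, by positivity⟩, AffineMap.lineMap_apply_one]
      have := hf1 0 ⟨le_rfl, hpi.le⟩
      rw [zero_div, AffineMap.lineMap_apply_zero] at this
      exact this.of_mem_frontier hp true

theorem exists_eq_coe_add_pi_mul (s : ℝ) (θ : Circ) : ∃ x ∈ Icc (0 : ℝ) 1,
    θ = ((s + Real.pi * x : ℝ) : Circ) ∨ θ = ((s + Real.pi + Real.pi * x : ℝ) : Circ) := by
  have hpi := Real.pi_pos
  have : Fact (0 < 2 * Real.pi) := ⟨by positivity⟩
  obtain ⟨t, ht, rfl⟩ : ∃ t ∈ Ico s (s + 2 * Real.pi), (t : Circ) = θ := by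
    have := AddCircle.coe_image_Ico_eq (2 * Real.pi) s
    obtain ⟨t, ht, h⟩ := this.symm ▸ mem_univ θ
    exact ⟨t, ht, h⟩
  rcases le_total t (s + Real.pi) with h | h
  · refine ⟨(t - s) / Real.pi, ⟨div_nonneg (by linarith [ht.1]) hpi.le,
      (div_le_one hpi).2 (by linarith)⟩, Or.inl ?_⟩
    congr 1
    field_simp
    ring
  · refine ⟨(t - s - Real.pi) / Real.pi, ⟨div_nonneg (by linarith) hpi.le,
      (div_le_one hpi).2 (by linarith [ht.2])⟩, Or.inr ?_⟩
    congr 1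
    field_simp
    ring

theorem RunsAround.exists_forall_eq (hγ : RunsAround γ p q) (hδ : RunsAround δ p q) :
    ∃ s : Circ, ∀ t, δ t = γ (s + t) := by
  obtain ⟨s, hs⟩ := hγ
  obtain ⟨s', hs'⟩ := hδ
  refine ⟨((s - s' : ℝ) : Circ), fun t => ?_⟩
  obtain ⟨x, hx, rfl | rfl⟩ := exists_eq_coe_add_pi_mul s' t
  · rw [← AddCircle.coe_add, show s - s' + (s' + Real.pi * x) = s + Real.pi * x by ring]
    exact (hs' x hx).1.ext (hs x hx).1
  · rw [← AddCircle.coe_add,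
      show s - s' + (s' + Real.pi + Real.pi * x) = s + Real.pi + Real.pi * x by ring]
    exact (hs' x hx).2.ext (hs x hx).2

theorem RunsAround.neg (hγ : RunsAround γ p q) : RunsAround (fun t => γ (-t)) q p := by
  obtain ⟨s, hs⟩ := hγ
  -- The reversed curve must start at `q` and traverse face `false` first, hence the shift by `π`.
  refine ⟨-(s + Real.pi), fun x hx => ?_⟩
  obtain ⟨h1, h2⟩ := hs (1 - x) ⟨by linarith [hx.2], by linarith [hx.1]⟩
  rw [AffineMap.lineMap_apply_one_sub] at h1 h2
  have e1 : -((-(s + Real.pi) + Real.pi * x : ℝ) : Circ) = ((s + Real.pi * (1 - x) : ℝ) : Circ) := by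
    rw [← AddCircle.coe_neg]
    congr 1
    ring
  have e2 : -((-(s + Real.pi) + Real.pi + Real.pi * x : ℝ) : Circ) =
      ((s + Real.pi + Real.pi * (1 - x) : ℝ) : Circ) := by
    rw [← AddCircle.coe_neg, ← coe_add_two_pi (-(-(s + Real.pi) + Real.pi + Real.pi * x))]
    congr 1
    ring
  simp only [e1, e2]
  exact ⟨h1, h2⟩

theorem RunsAround.exists_forall_eq_sub (hγ : RunsAround γ p q) (hδ : RunsAround δ q p) :
    ∃ s : Circ, ∀ t, δ t = γ (s - t) := by
  obtain ⟨s, hs⟩ := hγ.neg.exists_forall_eq hδ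
  exact ⟨-s, fun t => by rw [hs, neg_add']⟩

theorem RunsAround.exists_eq_lineMap (hγ : RunsAround γ p q) {i : Bool} {z : ℂ} {t : Circ}
    (hz : IsFacePoint i z (γ t)) : ∃ x ∈ Icc (0 : ℝ) 1, z = AffineMap.lineMap p q x := by
  obtain ⟨s, hs⟩ := hγ
  obtain ⟨x, hx, rfl | rfl⟩ := exists_eq_coe_add_pi_mul s t
  · exact ⟨x, hx, hz.eq (hs x hx).1⟩
  · refine ⟨1 - x, ⟨by linarith [hx.2], by linarith [hx.1]⟩, ?_⟩
    rw [AffineMap.lineMap_apply_one_sub]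
    exact hz.eq (hs x hx).2

end RunsAround

/-! ### Counting the central curves -/

section Classification

open Set

variable {n : ℕ} {c w : ℂ} {γ δ : Circ → DoubledNGon n c w}

theorem edgeMidpoint_add_half_add_half (hn : 0 < n) (he : Even n) (k : ℕ) :
    edgeMidpoint n c w (k + n / 2 + n / 2) = edgeMidpoint n c w k := by
  rw [add_assoc, ← two_mul, Nat.two_mul_div_two_of_even he, edgeMidpoint_add_self hn]

theorem midpoint_edgeMidpoint (hn : 0 < n) (he : Even n) (k : ℕ) :
    midpoint ℝ (edgeMidpoint n c w k) (edgeMidpoint n c w (k + n / 2)) = c := by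
  have h := edgeMidpoint_add_half (c := c) (w := w) hn he k
  rw [midpoint_eq_smul_add, invOf_eq_inv, Complex.real_smul]
  push_cast
  linear_combination h / 2

theorem dist_edgeMidpoint_opposite (hn : 3 ≤ n) (he : Even n) (k : ℕ) :
    dist (edgeMidpoint n c w k) (edgeMidpoint n c w (k + n / 2)) =
      2 * (‖w‖ * Real.cos (Real.pi / n)) := by
  have h := edgeMidpoint_add_half (c := c) (w := w) (by omega) he k
  rw [← dist_edgeMidpoint_center (c := c) (w := w) hn k, dist_eq_norm, dist_eq_norm, ← Real.norm_two,
    ← norm_smul]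
  congr 1
  rw [two_smul]
  linear_combination -h

theorem edgeMidpoint_ne_opposite (hn : 3 ≤ n) (hw : w ≠ 0) (he : Even n) (k : ℕ) :
    edgeMidpoint n c w k ≠ edgeMidpoint n c w (k + n / 2) := by
  rw [← dist_pos, dist_edgeMidpoint_opposite hn he]
  have := cos_pi_div_pos hn
  have := norm_pos_iff.2 hw
  positivity

theorem inner_edgeMidpoint_sub_center (k : ℕ) :
    inner ℝ (edgeMidpoint n c w k - c) (vertex n c w (k + 1) - vertex n c w k) = 0 := by
  have h1 : edgeMidpoint n c w k - c = (⅟2 : ℝ) • (ray n w (k + 1) + ray n w k) := by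
    rw [edgeMidpoint, midpoint_eq_smul_add, vertex_eq, vertex_eq, invOf_eq_inv, Complex.real_smul,
      Complex.real_smul]
    push_cast
    ring
  rw [h1, vertex_eq, vertex_eq, add_sub_add_left_eq_sub, real_inner_smul_left,
    (real_inner_add_sub_eq_zero_iff _ _).2 (by rw [norm_ray, norm_ray]), mul_zero]

theorem RunsAround.isCentralCurve (hn : 0 < n) (he : Even n) {k : ℕ}
    (h : RunsAround γ (edgeMidpoint n c w k) (edgeMidpoint n c w (k + n / 2))) :
    IsCentralCurve γ k := by
  have hopp := edgeMidpoint_add_half (c := c) (w := w) hn he k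
  refine ⟨h, ?_, ?_, ?_⟩
  · obtain ⟨s, hs⟩ := h
    obtain ⟨h1, h2⟩ := hs (1 / 2) (by constructor <;> norm_num)
    rw [lineMap_one_half, midpoint_edgeMidpoint hn he] at h1
    rw [lineMap_one_half, midpoint_comm, midpoint_edgeMidpoint hn he] at h2
    exact fun i => Bool.rec ⟨_, h1⟩ ⟨_, h2⟩ i
  · rw [show edgeMidpoint n c w (k + n / 2) - edgeMidpoint n c w k =
      (-2 : ℝ) • (edgeMidpoint n c w k - c) by
        rw [Complex.real_smul]; push_cast; linear_combination hopp,
      real_inner_smul_left, inner_edgeMidpoint_sub_center, mul_zero]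
  · rw [show edgeMidpoint n c w (k + n / 2) - edgeMidpoint n c w k =
      (2 : ℝ) • (edgeMidpoint n c w (k + n / 2) - c) by
        rw [Complex.real_smul]; push_cast; linear_combination -hopp,
      real_inner_smul_left, inner_edgeMidpoint_sub_center, mul_zero]

theorem RunsAround.isHalfGeodesic_of_edgeMidpoint (hn : 3 ≤ n) (hw : w ≠ 0) (he : Even n) {k : ℕ}
    (h : RunsAround γ (edgeMidpoint n c w k) (edgeMidpoint n c w (k + n / 2))) :
    IsHalfGeodesic γ := by
  refine h.isHalfGeodesic (edgeMidpoint_ne_opposite hn hw he k) fun z hz => ?_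
  rw [dist_edgeMidpoint_opposite hn he, midpoint_edgeMidpoint (by omega) he, dist_comm,
    mul_div_cancel_left₀ _ two_ne_zero]
  exact le_dist_center_of_mem_frontier (by omega) hz

theorem IsHalfGeodesic.even_and_runsAround (hn : 3 ≤ n) (hw : w ≠ 0) (h : IsHalfGeodesic γ) :
    Even n ∧ ∃ k, RunsAround γ (edgeMidpoint n c w k) (edgeMidpoint n c w (k + n / 2)) := by
  obtain ⟨p, hp, q, hq, hr, hpq, hfr⟩ := h.exists_runsAround
  obtain ⟨he, k, rfl, rfl⟩ := even_and_eq_edgeMidpoint_of_le_dist hn hw hp hq hpq hfr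
  exact ⟨he, k, hr⟩

theorem edgeMidpoint_injOn (hn : 3 ≤ n) (hw : w ≠ 0) {j k : ℕ} (hj : j < n) (hk : k < n)
    (h : edgeMidpoint n c w j = edgeMidpoint n c w k) : j = k := by
  have hc : ((Real.cos (Real.pi / n) : ℝ) : ℂ) ≠ 0 := by exact_mod_cast (cos_pi_div_pos hn).ne'
  have hpow : ∀ k, ray n w k = w * Complex.exp (2 * Real.pi * Complex.I / n) ^ k := fun k => by
    rw [ray, ← Complex.exp_nat_mul]
    congr 2
    ring
  rw [edgeMidpoint_eq, edgeMidpoint_eq, add_right_inj, mul_right_inj' hc, edgeNormal, edgeNormal,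
    mul_left_inj' (Complex.exp_ne_zero _), hpow, hpow, mul_right_inj' hw] at h
  exact (Complex.isPrimitiveRoot_exp n (by omega)).pow_inj hj hk h

/-- Lowering the index by `n / 2` exchanges the two ends of the pair, so the index matters only
modulo `n / 2` up to order. -/
theorem exists_lt_half_edgeMidpoint (hn : 3 ≤ n) (he : Even n) (k : ℕ) : ∃ j < n / 2,
    (edgeMidpoint n c w k = edgeMidpoint n c w j ∧
      edgeMidpoint n c w (k + n / 2) = edgeMidpoint n c w (j + n / 2)) ∨
    (edgeMidpoint n c w k = edgeMidpoint n c w (j + n / 2) ∧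
      edgeMidpoint n c w (k + n / 2) = edgeMidpoint n c w j) := by
  induction k using Nat.strong_induction_on with
  | _ k ih =>
    by_cases hk : k < n / 2
    · exact ⟨k, hk, Or.inl ⟨rfl, rfl⟩⟩
    · obtain ⟨l, rfl⟩ := Nat.exists_eq_add_of_le' (not_lt.1 hk)
      obtain ⟨j, hj, h⟩ := ih l (by omega)
      rw [edgeMidpoint_add_half_add_half (by omega) he]
      exact ⟨j, hj, h.symm.imp And.symm And.symm⟩

/-- The image determines the index: on a segment through `c` joining opposite edge midpoints, only
the two ends are at distance the apothem from `c`. -/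
theorem eq_of_runsAround_of_range_subset (hn : 3 ≤ n) (hw : w ≠ 0) (he : Even n) {j k : ℕ}
    (hj : j < n / 2) (hk : k < n / 2)
    (hγ : RunsAround γ (edgeMidpoint n c w j) (edgeMidpoint n c w (j + n / 2)))
    (hδ : RunsAround δ (edgeMidpoint n c w k) (edgeMidpoint n c w (k + n / 2)))
    (h : ∀ t, ∃ s, δ t = γ s) : j = k := by
  have ha : 0 < ‖w‖ * Real.cos (Real.pi / n) :=
    mul_pos (norm_pos_iff.2 hw) (cos_pi_div_pos hn)
  obtain ⟨s, hs⟩ := hδ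
  have h0 := (hs 0 (by simp)).1
  obtain ⟨t, ht⟩ := h ((s + Real.pi * 0 : ℝ) : Circ)
  rw [AffineMap.lineMap_apply_zero, ht] at h0
  obtain ⟨x, hx, hkx⟩ := hγ.exists_eq_lineMap h0
  have h1 : edgeMidpoint n c w k - c = (1 - 2 * x) • (edgeMidpoint n c w j - c) := by
    have hopp := edgeMidpoint_add_half (c := c) (w := w) (by omega) he j
    rw [hkx, AffineMap.lineMap_apply_module', Complex.real_smul, Complex.real_smul]
    push_cast
    linear_combination (x : ℂ) * hopp
  have h2 := congrArg norm h1
  rw [norm_smul, Real.norm_eq_abs, ← dist_eq_norm, ← dist_eq_norm, dist_edgeMidpoint_center hn,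
    dist_edgeMidpoint_center hn] at h2
  have h3 : |1 - 2 * x| = 1 := mul_right_cancel₀ ha.ne' (by rw [← h2, one_mul])
  rcases (abs_eq zero_le_one).1 h3 with h4 | h4
  · obtain rfl : x = 0 := by linarith
    rw [AffineMap.lineMap_apply_zero] at hkx
    exact (edgeMidpoint_injOn hn hw (by omega) (by omega) hkx).symm
  · obtain rfl : x = 1 := by linarith
    rw [AffineMap.lineMap_apply_one] at hkx
    have := edgeMidpoint_injOn hn hw (by omega) (by omega) hkx
    omega

theorem card_geometricHalfGeodesic (hn : 3 ≤ n) (hw : w ≠ 0) (he : Even n) :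
    Nat.card (GeometricHalfGeodesic (DoubledNGon n c w)) = n / 2 := by
  have hex : ∀ k : ℕ, ∃ γ : Circ → DoubledNGon n c w,
      RunsAround γ (edgeMidpoint n c w k) (edgeMidpoint n c w (k + n / 2)) := fun k =>
    exists_runsAround (edgeMidpoint_mem_frontier hn hw k) (edgeMidpoint_mem_frontier hn hw _)
  choose Γ hΓ using hex
  let F : Fin (n / 2) → GeometricHalfGeodesic (DoubledNGon n c w) := fun k =>
    Quotient.mk _ ⟨Γ k, (hΓ k).isHalfGeodesic_of_edgeMidpoint hn hw he⟩
  rw [← Nat.card_eq_of_bijective F, Nat.card_fin]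
  refine ⟨fun j k hjk => ?_, fun x => ?_⟩
  · obtain ⟨s, hs | hs⟩ := Quotient.exact hjk
    · exact Fin.ext (eq_of_runsAround_of_range_subset hn hw he j.2 k.2 (hΓ j) (hΓ k)
        fun t => ⟨_, hs t⟩)
    · exact Fin.ext (eq_of_runsAround_of_range_subset hn hw he j.2 k.2 (hΓ j) (hΓ k)
        fun t => ⟨_, hs t⟩)
  · induction x using Quotient.inductionOn with
    | h γ =>
      obtain ⟨-, k, hk⟩ := γ.2.even_and_runsAround hn hw
      obtain ⟨j, hj, ⟨h1, h2⟩ | ⟨h1, h2⟩⟩ := exists_lt_half_edgeMidpoint (c := c) (w := w) hn he k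
      · rw [h1, h2] at hk
        obtain ⟨s, hs⟩ := (hΓ j).exists_forall_eq hk
        exact ⟨⟨j, hj⟩, Quotient.sound ⟨s, Or.inl hs⟩⟩
      · rw [h1, h2] at hk
        obtain ⟨s, hs⟩ := (hΓ j).exists_forall_eq_sub hk
        exact ⟨⟨j, hj⟩, Quotient.sound ⟨s, Or.inr hs⟩⟩

end Classification

end DoubledPolygon

theorem mainTheorem3 (n : ℕ) (hn : 3 ≤ n) (c w : ℂ) (hw : w ≠ 0) :
    (Odd n → ∀ γ : DoubledPolygon.Circ → DoubledPolygon.DoubledNGon n c w,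
      ¬ DoubledPolygon.IsHalfGeodesic γ) ∧
    (Even n →
      Nat.card (DoubledPolygon.GeometricHalfGeodesic (DoubledPolygon.DoubledNGon n c w)) = n / 2 ∧
      ∀ γ : DoubledPolygon.Circ → DoubledPolygon.DoubledNGon n c w,
        DoubledPolygon.IsHalfGeodesic γ ↔ ∃ k : ℕ, DoubledPolygon.IsCentralCurve γ k) := by
  refine ⟨fun ho γ h => ?_, fun he => ⟨DoubledPolygon.card_geometricHalfGeodesic hn hw he,
    fun γ => ⟨fun h => ?_, ?_⟩⟩⟩
  · exact Nat.not_even_iff_odd.2 ho (h.even_and_runsAround hn hw).1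
  · obtain ⟨-, k, hk⟩ := h.even_and_runsAround hn hw
    exact ⟨k, hk.isCentralCurve (by omega) he⟩
  · rintro ⟨k, hk⟩
    exact hk.runsAround.isHalfGeodesic_of_edgeMidpoint hn hw he
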